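/- Let $T>0$ and let $\Omega\subset\mathbb R^2$ be a bounded domain (nonempty, open, connected) with $C^\infty$ boundary, $\Omega_T=(0,T)\times\Omega$, with outward unit normal $\mathbf n$. Let $\overline\sigma\in C^2([0,T]\times\overline\Omega;\mathbb R)$ with $\inf_{[0,T]\times\overline\Omega}\overline\sigma>0$, and let $\overline{\mathbf y}\in C^2([0,T]\times\overline\Omega;\mathbb R^2)$ with $\operatorname{div}\overline{\mathbf y}=0$ in $\Omega_T$. Extend $\overline{\mathbf y}$ to a $C^2$ vector field on $[0,T]\times\mathbb R^2$ that has a flow $\overline X$ on $[0,T]^2\times\mathbb R^2$, i.e. $\partial_t\overline X(t,\tau,x)=\overline{\mathbf y}(t,\overline X(t,\tau,x))$, $\overline X(\tau,\tau,x)=x$. Assume that for every $x\in\overline\Omega$ there is $t\in(0,T)$ with $\overline X(t,0,x)\notin\overline\Omega$. Let $\Gamma_0$ be a relatively open subset of $\partial\Omega$ with finitely many connected components, such that for some $\gamma>0$, $\overline{\mathbf y}(t,x)\cdot\mathbf n(x)\ge\gamma$ for all $(t,x)\in[0,T]\times\overline{\Gamma_0}$. Then there is a bounded domain $\mathcal O\subset\mathbb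 R^2$ with boundary of class $C^2$, with $\Omega\subset\mathcal O$, $\Gamma_0\subset\partial\mathcal O\cap\partial\Omega$ and $\mathcal O\setminus\overline\Omega\neq\emptyset$, such that for all domains (nonempty, open, connected) $\omega\subset\mathcal O\setminus\overline\Omega$ and $\tilde\omega\Subset\omega$ (that is, $\tilde\omega\subset K\subset\omega$ for some compact $K$) there is $\tilde\psi\in C^2([0,T]\times\overline{\mathcal O})$ with the following properties: 1. $\partial_t\tilde\psi+\overline{\mathbf y}\cdot\nabla\tilde\psi=0$ in $\Omega_T$; 2. $\tilde\psi(t,x)\in[0,1]$ for all $(t,x)\in[0,T]\times\overline{\mathcal O}$; 3. $\partial_{\mathbf n}\tilde\psi(t,x)\le 0$ for all $(t,x)\in(0,T)\times\partial\mathcal O$, where $\mathbf n$ is here the outward unit normal to $\mathcal O$; 4. for every $t\in[0,T]$, $\tilde\psi(t,\cdot)$ is constant on $\partial\mathcal O$, and $\inf_{\mathcal O}\tilde\psi(t,\cdot)$ equals this constant; 5. there is $\alpha>0$ such that $|\nabla\tilde\psi(t,x)|\ge\alpha$ for all $t\in(0,T)$ and $x\in\mathcal O\setminus\tilde\omega$.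 -/

import Mathlib

open Set Topology

/-- The Euclidean plane `ℝ²`. -/
abbrev Plane : Type := EuclideanSpace ℝ (Fin 2)

/-- `ρ` is a local defining function of class `C^n` for the set `Ω` near the boundary point `x`:
near `x`, the set `Ω` is `{ρ < 0}`, and `∇ρ(x) ≠ 0`. -/
def IsDefiningFunctionAt (n : WithTop ℕ∞) (Ω : Set Plane) (x : Plane) (ρ : Plane → ℝ) : Prop :=
  ContDiff ℝ n ρ ∧ gradient ρ x ≠ 0 ∧ ∀ᶠ z in 𝓝 x, (z ∈ Ω ↔ ρ z < 0)

/-- A subdomain of the plane: a nonempty connected open set. -/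
def IsDomainSet (U : Set Plane) : Prop := IsOpen U ∧ IsConnected U

/-- A bounded domain of `ℝ²` with boundary of class `C^n` (locally on one side of it). -/
structure IsBoundedDomainOfClass (n : WithTop ℕ∞) (Ω : Set Plane) : Prop where
  isDomain : IsDomainSet Ω
  isBounded : Bornology.IsBounded Ω
  boundary : ∀ x ∈ frontier Ω, ∃ ρ, IsDefiningFunctionAt n Ω x ρ

/-- `ν` is the outward unit normal to `Ω` at the boundary point `x`. -/
def IsOuterNormal (Ω : Set Plane) (x ν : Plane) : Prop :=
  ‖ν‖ = 1 ∧ ∃ ρ, IsDefiningFunctionAt 1 Ω x ρ ∧ ∃ c : ℝ, 0 < c ∧ gradient ρ x = c • ν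

/-- The divergence of a vector field on the plane. -/
noncomputable def planeDiv (v : Plane → Plane) (x : Plane) : ℝ :=
  ∑ i : Fin 2, (fderiv ℝ v x (EuclideanSpace.single i 1)) i

/-- `X = X(t, τ, x)` is the flow on `[0,T]² × ℝ²` of the time-dependent vector field `y`:
`∂ₜ X(t,τ,x) = y(t, X(t,τ,x))` (one-sided at `t = 0, T`) and `X(τ,τ,x) = x`. -/
def IsFlow (T : ℝ) (y : ℝ → Plane → Plane) (X : ℝ → ℝ → Plane → Plane) : Prop :=
  ∀ τ ∈ Icc 0 T, ∀ x : Plane, X τ τ x = x ∧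
    ∀ t ∈ Icc 0 T, HasDerivWithinAt (fun s => X s τ x) (y t (X t τ x)) (Icc 0 T) t

/-- The points of the closure of `Ω` which, started at time `0`, are carried by the flow `X` out of
the closure of `Ω` at some time in `(0,T)`. -/
def outgoingSet (Ω : Set Plane) (T : ℝ) (X : ℝ → ℝ → Plane → Plane) : Set Plane :=
  {x ∈ closure Ω | ∃ t ∈ Ioo 0 T, X t 0 x ∉ closure Ω}

/-- `U` is compactly included in `V`. -/
def CompactlyIncluded (U V : Set Plane) : Prop := ∃ K, IsCompact K ∧ U ⊆ K ∧ K ⊆ V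

/-- The domain `𝒪` is a `C²` bounded extension of `Ω` whose boundary still contains `Γ₀`. -/
structure IsExtendedDomain (Ω Γ₀ 𝒪 : Set Plane) : Prop where
  isDomain : IsBoundedDomainOfClass 2 𝒪
  subset : Ω ⊆ 𝒪
  boundary : Γ₀ ⊆ frontier 𝒪 ∩ frontier Ω

/-- The weight function on `[0,T] × closure 𝒪`, transported by `y` in `(0,T) × Ω`, with no critical
point in space outside `ω'`. -/
structure IsTransportedWeight (T : ℝ) (Ω 𝒪 ω' : Set Plane) (y : ℝ → Plane → Plane)
    (ψ : ℝ → Plane → ℝ) : Prop where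
  regular : ContDiffOn ℝ 2 (Function.uncurry ψ) (Icc 0 T ×ˢ closure 𝒪)
  transport : ∀ t ∈ Ioo 0 T, ∀ x ∈ Ω,
    deriv (fun s => ψ s x) t + inner ℝ (y t x) (gradient (ψ t) x) = 0
  range : ∀ t ∈ Icc 0 T, ∀ x ∈ closure 𝒪, ψ t x ∈ Icc (0 : ℝ) 1
  normal : ∀ t ∈ Ioo 0 T, ∀ x ∈ frontier 𝒪, ∀ ν, IsOuterNormal 𝒪 x ν →
    inner ℝ (gradientWithin (ψ t) (closure 𝒪) x) ν ≤ 0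
  boundary_inf : ∀ t ∈ Icc 0 T, ∃ c : ℝ, (∀ x ∈ frontier 𝒪, ψ t x = c) ∧ IsGLB (ψ t '' 𝒪) c
  noncritical : ∃ α : ℝ, 0 < α ∧ ∀ t ∈ Ioo 0 T, ∀ x ∈ 𝒪 \ ω', α ≤ ‖gradient (ψ t) x‖

/-! The weight is built as ψ(t,x) = f(e(T;t,x)), where e is the evolution of a field V equal to y on
[0,T] × Ω. Such a ψ is constant along the trajectories of V, hence transported by y in Ω. It remains
to choose 𝒪, V and f.

The closure of Γ₀ cannot be all of ∂Ω: otherwise y would point outwards along the whole boundary,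
and a trajectory ending in Ω at time T would have stayed in Ω since time 0, although every particle
leaves. Pushing ∂Ω outwards off the closure of Γ₀ thus gives a strictly larger 𝒪 whose boundary
meets the closure of Ω exactly in the closure of Γ₀ (`exists_enlargement`). There y is outward; on
the rest of ∂𝒪 the field is free. So V can be made outward on ∂𝒪 throughout [0,T], and zero on a
ball B inside ω̃ (`exists_outward_field`).

Since V crosses ∂𝒪 only outwards, the exit time τ of a particle, labelled by its position at time T,
is C² where defined and has no critical point (`exists_exit_time`). Put f = τ outside 𝒪: then ψ(t,·)
= t on ∂𝒪, and a particle inside at time t leaves later, so t is the minimum. Positivity of the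
normal derivative along -ν follows from minimality. Inside 𝒪, f must exceed T and have its critical
points in B. To get this, τ is interpolated with a constant, made to have finitely many critical
points by Sard's theorem, and composed with a diffeomorphism moving these points into B
(`exists_contDiffOn_critical_subset`). As V vanishes on B, the critical points of ψ(t,·) stay in B
at every time; compactness gives α, and division by a constant puts the range in [0,1].

The auxiliary parts prove C^n dependence of flows on the initial data and C² extension across t = 0
and t = T. -/

/-! ### Differentiability of superposition operators on continuous paths -/

section Superposition

variable {α : Type} [TopologicalSpace α] [CompactSpace α]
  {E F : Type} [NormedAddCommGroup E] [NormedSpace ℝ E] [NormedAddCommGroup F] [NormedSpace ℝ F]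

/-- Pointwise application of a continuous family of operators to a continuous function. -/
noncomputable def ContinuousMap.pointwiseCLM :
    C(α, E →L[ℝ] F) →L[ℝ] (C(α, E) →L[ℝ] C(α, F)) :=
  LinearMap.mkContinuous₂
    (LinearMap.mk₂ ℝ (fun (A : C(α, E →L[ℝ] F)) (h : C(α, E)) => (⟨fun s => A s (h s), by fun_prop⟩ : C(α, F)))
      (by intros; ext; simp) (by intros; ext; simp) (by intros; ext; simp) (by intros; ext; simp))
    1 (by
      intro A h
      rw [one_mul, ContinuousMap.norm_le _ (by positivity)]
      intro s
      exact ((A s).le_opNorm _).trans (mul_le_mul (A.norm_coe_le_norm s) (h.norm_coe_le_norm s)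
        (norm_nonneg _) (by positivity)))

@[simp] lemma ContinuousMap.pointwiseCLM_apply (A : C(α, E →L[ℝ] F)) (h : C(α, E)) (s : α) :
    ContinuousMap.pointwiseCLM A h s = A s (h s) := rfl

lemma ContinuousMap.norm_pointwiseCLM_apply_le (A : C(α, E →L[ℝ] F)) :
    ‖ContinuousMap.pointwiseCLM A‖ ≤ ‖A‖ := by
  refine ContinuousLinearMap.opNorm_le_bound _ (by positivity) fun h => ?_
  rw [ContinuousMap.norm_le _ (by positivity)]
  intro s
  exact ((A s).le_opNorm _).trans (mul_le_mul (A.norm_coe_le_norm s) (h.norm_coe_le_norm s)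
    (norm_nonneg _) (by positivity))

/-- The mean value inequality at each `s`, with a radius uniform in `s`. Uniformity comes from
continuity of γ ↦ f' ∘ γ for the sup norm. -/
lemma hasFDerivAt_superposition (f : C(E, F)) (f' : C(E, E →L[ℝ] F))
    (hf : ∀ x, HasFDerivAt f (f' x) x) (γ : C(α, E)) :
    HasFDerivAt (fun γ : C(α, E) => f.comp γ)
      (ContinuousMap.pointwiseCLM (f'.comp γ)) γ := by
  rw [hasFDerivAt_iff_isLittleO_nhds_zero, Asymptotics.isLittleO_iff]
  intro ε hε
  have hcont : Continuous fun γ : C(α, E) => f'.comp γ := f'.continuous_postcomp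
  have hev : ∀ᶠ g in 𝓝 γ, dist (f'.comp g) (f'.comp γ) < ε :=
    (hcont.tendsto γ).eventually (Metric.ball_mem_nhds (f'.comp γ) hε)
  obtain ⟨δ, hδ, h⟩ := Metric.eventually_nhds_iff.1 hev
  filter_upwards [Metric.ball_mem_nhds (0 : C(α, E)) hδ] with k hk
  rw [ContinuousMap.norm_le _ (by positivity)]
  intro s
  have hks : ‖k s‖ < δ := (k.norm_coe_le_norm s).trans_lt (by simpa using hk)
  have key : ∀ x ∈ Metric.ball (γ s) δ, ‖f' x - f' (γ s)‖ ≤ ε := by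
    intro x hx
    -- The constant translate of `γ` taking the value `x` at `s` turns the sup norm estimate into an
    -- estimate at `x`.
    have h1 : dist (γ + ContinuousMap.const α (x - γ s)) γ < δ := by
      rw [dist_eq_norm, add_sub_cancel_left]
      refine lt_of_le_of_lt ((ContinuousMap.norm_le _ (norm_nonneg (x - γ s))).2 fun _ => le_rfl) ?_
      simpa [dist_eq_norm] using hx
    have h2 := (ContinuousMap.dist_apply_le_dist s).trans (h h1).le
    simpa [dist_eq_norm] using h2
  have := (convex_ball (γ s) δ).norm_image_sub_le_of_norm_hasFDerivWithin_le' (f := f) (f' := f')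
    (φ := f' (γ s)) (fun x _ => (hf x).hasFDerivWithinAt) key (Metric.mem_ball_self hδ)
    (y := γ s + k s) (by simpa using hks)
  simp only [add_sub_cancel_left] at this
  refine this.trans ?_
  gcongr
  exact k.norm_coe_le_norm s

/-- The derivative is a continuous linear image of the superposition by f', so induction applies;
the target space varies because f' is operator-valued. -/
lemma contDiff_superposition (n : ℕ) : ∀ {F : Type} [NormedAddCommGroup F] [NormedSpace ℝ F]
    (f : C(E, F)), ContDiff ℝ n f → ContDiff ℝ n (fun γ : C(α, E) => f.comp γ) := by
  induction n with
  | zero =>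
    intro F _ _ f _
    exact contDiff_zero.2 f.continuous_postcomp
  | succ n ih =>
    intro F _ _ f hf
    rw [Nat.cast_succ] at hf ⊢
    obtain ⟨h1, h2, h3⟩ := contDiff_succ_iff_hasFDerivAt.1 hf
    let f' : C(E, E →L[ℝ] F) := ⟨h1, h2.continuous⟩
    refine contDiff_succ_iff_hasFDerivAt.2
      ⟨fun γ => ContinuousMap.pointwiseCLM (f'.comp γ), ?_, hasFDerivAt_superposition f f' h3⟩
    exact ContinuousMap.pointwiseCLM.contDiff.comp (ih f' h2)

end Superposition

/-! ### Global flows of bounded Lipschitz fields -/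

section Flow

variable {E : Type} [NormedAddCommGroup E] [NormedSpace ℝ E]

/-- `φ` is the global flow of the autonomous vector field `F`. -/
structure IsGlobalFlow (F : E → E) (φ : ℝ → E → E) : Prop where
  zero : ∀ x, φ 0 x = x
  deriv : ∀ x t, HasDerivAt (fun s => φ s x) (F (φ t x)) t

lemma exists_integralCurve_Ioo [CompleteSpace E] {F : E → E} {K : NNReal} (hL : LipschitzWith K F)
    {M : ℝ} (hB : ∀ x, ‖F x‖ ≤ M) (x : E) {R : ℝ} (hR : 0 < R) :
    ∃ γ : ℝ → E, γ 0 = x ∧ ∀ t ∈ Ioo (-R) R, HasDerivAt γ (F (γ t)) t := by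
  have hM : 0 ≤ M := (norm_nonneg _).trans (hB x)
  have h0 : (0 : ℝ) ∈ Icc (-R) R := ⟨by linarith, hR.le⟩
  -- The field being bounded by `M` everywhere, the ball of radius `M * R` contains the solution for
  -- any prescribed `R`.
  have hPL : IsPicardLindelof (fun _ : ℝ => F) (tmin := -R) (tmax := R) ⟨0, h0⟩ x
      (Real.toNNReal (M * R)) 0 (Real.toNNReal M) K := by
    refine IsPicardLindelof.of_time_independent (fun y _ => ?_) hL.lipschitzOnWith ?_
    · rw [Real.coe_toNNReal _ hM]; exact hB y
    · rw [Real.coe_toNNReal _ hM, Real.coe_toNNReal _ (by positivity)]; simp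
  obtain ⟨γ, h1, h2⟩ := hPL.exists_eq_forall_mem_Icc_hasDerivWithinAt₀
  exact ⟨γ, h1, fun t ht => (h2 t (Ioo_subset_Icc_self ht)).hasDerivAt (Icc_mem_nhds ht.1 ht.2)⟩

theorem exists_isGlobalFlow [CompleteSpace E] {F : E → E} {K : NNReal} (hL : LipschitzWith K F)
    {M : ℝ} (hB : ∀ x, ‖F x‖ ≤ M) : ∃ φ, IsGlobalFlow F φ := by
  choose γ h0 hd using fun (x : E) (n : ℕ) =>
    exists_integralCurve_Ioo hL hB x (R := (n : ℝ) + 1) (by positivity)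
  have hagree : ∀ x (m n : ℕ), m ≤ n → EqOn (γ x m) (γ x n) (Ioo (-((m : ℝ) + 1)) ((m : ℝ) + 1)) := by
    intro x m n hmn
    have hmn' : (m : ℝ) ≤ n := by exact_mod_cast hmn
    refine ODE_solution_unique_of_mem_Ioo (v := fun _ => F) (s := fun _ => univ) (K := K) (t₀ := 0)
      (fun t _ => hL.lipschitzOnWith) ⟨by linarith [m.cast_nonneg (α := ℝ)], by positivity⟩
      (fun t ht => ⟨hd x m t ht, trivial⟩)
      (fun t ht => ⟨hd x n t ⟨by linarith [ht.1], by linarith [ht.2]⟩, trivial⟩) ?_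
    rw [h0, h0]
  refine ⟨fun t x => γ x ⌈|t|⌉₊ t, fun x => ?_, fun x t => ?_⟩
  · simp [h0]
  -- The extra 1 lets the single curve `γ x N` represent the glued one on a whole neighbourhood of
  -- `t`.
  · set N : ℕ := ⌈|t|⌉₊ + 1
    have hlt : |t| < N := by
      have := Nat.le_ceil |t|
      simp only [N, Nat.cast_add, Nat.cast_one]; linarith
    have hmem : ∀ s : ℝ, |s| < N → s ∈ Ioo (-((N : ℝ) + 1)) ((N : ℝ) + 1) := fun s hs => by
      have := abs_lt.1 hs
      exact ⟨by linarith, by linarith⟩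
    have heq : ∀ s : ℝ, |s| < N → γ x ⌈|s|⌉₊ s = γ x N s := by
      intro s hs
      refine hagree x _ _ (Nat.ceil_le.2 hs.le) ?_
      have h1 := Nat.le_ceil |s|
      have h2 := neg_abs_le s
      have h3 := le_abs_self s
      exact ⟨by linarith, by linarith⟩
    have hev : (fun s => γ x ⌈|s|⌉₊ s) =ᶠ[𝓝 t] γ x N := by
      have : ∀ᶠ s : ℝ in 𝓝 t, |s| < (N : ℝ) := (continuous_abs.tendsto t).eventually (gt_mem_nhds hlt)
      filter_upwards [this] with s hs using heq s hs
    have := (hd x N t (hmem t hlt)).congr_of_eventuallyEq hev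
    rwa [← heq t hlt] at this

variable {F : E → E} {φ : ℝ → E → E} {K : NNReal}

lemma IsGlobalFlow.eq_of_integralCurve (hφ : IsGlobalFlow F φ) (hL : LipschitzWith K F) {γ : ℝ → E}
    (hγ : ∀ t, HasDerivAt γ (F (γ t)) t) (t : ℝ) : γ t = φ t (γ 0) := by
  have := ODE_solution_unique_univ (v := fun _ => F) (s := fun _ => univ) (K := K) (t₀ := 0)
    (f := γ) (g := fun s => φ s (γ 0)) (fun t => hL.lipschitzOnWith) (fun t => ⟨hγ t, trivial⟩)
    (fun t => ⟨hφ.deriv _ t, trivial⟩) (hφ.zero _).symm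
  exact congrFun this t

lemma IsGlobalFlow.add (hφ : IsGlobalFlow F φ) (hL : LipschitzWith K F) (s t : ℝ) (x : E) :
    φ (s + t) x = φ s (φ t x) := by
  have := hφ.eq_of_integralCurve hL (γ := fun s => φ (s + t) x)
    (fun s => (hφ.deriv x (s + t)).comp_add_const s t) s
  simpa using this

lemma IsGlobalFlow.neg_cancel (hφ : IsGlobalFlow F φ) (hL : LipschitzWith K F) (t : ℝ) (x : E) :
    φ (-t) (φ t x) = x := by
  rw [← hφ.add hL, neg_add_cancel, hφ.zero]

lemma IsGlobalFlow.neg_cancel' (hφ : IsGlobalFlow F φ) (hL : LipschitzWith K F) (t : ℝ) (x : E) :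
    φ t (φ (-t) x) = x := by
  rw [← hφ.add hL, add_neg_cancel, hφ.zero]

lemma IsGlobalFlow.eq_self (hφ : IsGlobalFlow F φ) (hL : LipschitzWith K F) {x : E} (hx : F x = 0)
    (t : ℝ) : φ t x = x := by
  refine (hφ.eq_of_integralCurve hL (γ := fun _ => x) (fun s => ?_) t).symm
  rw [hx]; exact hasDerivAt_const s x

lemma IsGlobalFlow.continuous_time (hφ : IsGlobalFlow F φ) (x : E) : Continuous fun s => φ s x :=
  continuous_iff_continuousAt.2 fun t => (hφ.deriv x t).continuousAt

open unitInterval in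
/-- The primitive vanishing at `0`, as an operator on continuous functions on `[0,1]`. -/
noncomputable def primitiveCLM (E : Type) [NormedAddCommGroup E] [NormedSpace ℝ E] :
    C(I, E) →L[ℝ] C(I, E) :=
  LinearMap.mkContinuous
    { toFun := fun γ => ⟨fun s => ∫ r in (0 : ℝ)..s, γ (projIcc 0 1 zero_le_one r), by
        have h : Continuous fun r => γ (projIcc (0 : ℝ) 1 zero_le_one r) :=
          γ.continuous.comp continuous_projIcc
        exact (intervalIntegral.continuous_primitive
          (fun a b => h.intervalIntegrable a b) 0).comp continuous_subtype_val⟩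
      map_add' := fun γ₁ γ₂ => by
        ext s
        simp only [ContinuousMap.coe_add, Pi.add_apply, ContinuousMap.coe_mk]
        exact intervalIntegral.integral_add
          ((γ₁.continuous.comp continuous_projIcc).intervalIntegrable _ _)
          ((γ₂.continuous.comp continuous_projIcc).intervalIntegrable _ _)
      map_smul' := fun c γ => by
        ext s
        simp }
    1 (by
      intro γ
      rw [one_mul, ContinuousMap.norm_le _ (norm_nonneg _)]
      intro s
      refine (intervalIntegral.norm_integral_le_of_norm_le_const
        (fun r _ => γ.norm_coe_le_norm _)).trans ?_
      rw [sub_zero, abs_of_nonneg s.2.1]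
      exact mul_le_of_le_one_right (norm_nonneg _) s.2.2)

open unitInterval in
lemma primitiveCLM_apply (γ : C(I, E)) (s : I) :
    primitiveCLM E γ s = ∫ r in (0 : ℝ)..s, γ (projIcc 0 1 zero_le_one r) := rfl

lemma norm_primitiveCLM_le : ‖primitiveCLM E‖ ≤ 1 :=
  LinearMap.mkContinuous_norm_le _ zero_le_one _

end Flow

/-! ### C^n dependence of the flow on time and initial value -/

section FlowSmooth

variable {E : Type} [NormedAddCommGroup E] [NormedSpace ℝ E]
variable {F : E → E} {φ : ℝ → E → E} {K : NNReal}

open unitInterval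

/-- The defect of `γ` in the integral equation of the vector field `F`, for the time `p.1.1` and
the initial value `p.1.2`. -/
noncomputable def integralDefect (F : C(E, E)) (p : (ℝ × E) × C(I, E)) : C(I, E) :=
  p.2 - ContinuousMap.const I p.1.2 - p.1.1 • primitiveCLM E (F.comp p.2)

/-- The orbit of `p.2` until the time `p.1`, rescaled to the unit interval. -/
noncomputable def IsGlobalFlow.path (hφ : IsGlobalFlow F φ) (p : ℝ × E) : C(I, E) :=
  ⟨fun s => φ (p.1 * s) p.2, (hφ.continuous_time p.2).comp (by fun_prop)⟩

lemma IsGlobalFlow.integralDefect_path [CompleteSpace E] (hφ : IsGlobalFlow F φ)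
    (hF : Continuous F) (p : ℝ × E) : integralDefect ⟨F, hF⟩ (p, hφ.path p) = 0 := by
  ext s
  have hc : Continuous fun r : ℝ => p.1 • F (φ (p.1 * r) p.2) :=
    continuous_const.smul (hF.comp ((hφ.continuous_time p.2).comp (by fun_prop)))
  have h1 : ∫ r in (0 : ℝ)..s, p.1 • F (φ (p.1 * r) p.2) = φ (p.1 * s) p.2 - φ (p.1 * 0) p.2 := by
    refine intervalIntegral.integral_eq_sub_of_hasDerivAt (f := fun r => φ (p.1 * r) p.2)
      (fun r _ => ?_) (hc.intervalIntegrable _ _)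
    have h2 : HasDerivAt (fun r : ℝ => p.1 * r) p.1 r := by
      simpa using (hasDerivAt_id r).const_mul p.1
    exact (hφ.deriv p.2 (p.1 * r)).scomp r h2
  have h3 : ∫ r in (0 : ℝ)..s, F (φ (p.1 * (projIcc (0 : ℝ) 1 zero_le_one r : ℝ)) p.2)
      = ∫ r in (0 : ℝ)..s, F (φ (p.1 * r) p.2) := by
    refine intervalIntegral.integral_congr fun r hr => ?_
    rw [uIcc_of_le s.2.1] at hr
    rw [projIcc_of_mem zero_le_one ⟨hr.1, hr.2.trans s.2.2⟩]
  rw [intervalIntegral.integral_smul] at h1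
  simp only [integralDefect, path, ContinuousMap.sub_apply, ContinuousMap.smul_apply,
    primitiveCLM_apply, ContinuousMap.comp_apply, ContinuousMap.coe_mk, ContinuousMap.const_apply,
    ContinuousMap.zero_apply]
  rw [h3, h1, mul_zero, hφ.zero]
  simp

/-- For |t|K < 1 the integral operator is a contraction, so the orbit is the only solution. -/
lemma IsGlobalFlow.eq_path [CompleteSpace E] (hφ : IsGlobalFlow F φ)
    (hL : LipschitzWith K F) {p : ℝ × E} (hp : |p.1| * K < 1) {γ : C(I, E)}
    (hγ : integralDefect ⟨F, hL.continuous⟩ (p, γ) = 0) : γ = hφ.path p := by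
  have h0 := hφ.integralDefect_path hL.continuous p
  have h1 : γ - hφ.path p = p.1 • primitiveCLM E
      ((⟨F, hL.continuous⟩ : C(E, E)).comp γ - (⟨F, hL.continuous⟩ : C(E, E)).comp (hφ.path p)) := by
    have := hγ.trans h0.symm
    simp only [integralDefect] at this
    rw [map_sub, smul_sub, sub_eq_sub_iff_add_eq_add]
    rw [sub_eq_sub_iff_add_eq_add] at this
    have h3 : γ + p.1 • primitiveCLM E ((⟨F, hL.continuous⟩ : C(E, E)).comp (hφ.path p))
      = hφ.path p + p.1 • primitiveCLM E ((⟨F, hL.continuous⟩ : C(E, E)).comp γ) := by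
      have := congrArg (· + ContinuousMap.const I p.2) this
      calc _ = _ := by abel
        _ = _ := this
        _ = _ := by abel
    rw [h3, add_comm]
  have h2 : ‖(⟨F, hL.continuous⟩ : C(E, E)).comp γ
      - (⟨F, hL.continuous⟩ : C(E, E)).comp (hφ.path p)‖ ≤ K * ‖γ - hφ.path p‖ := by
    rw [ContinuousMap.norm_le _ (by positivity)]
    intro s
    refine (hL.norm_sub_le _ _).trans ?_
    gcongr
    exact (γ - hφ.path p).norm_coe_le_norm s
  have h3 : ‖γ - hφ.path p‖ ≤ |p.1| * (K * ‖γ - hφ.path p‖) := by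
    conv_lhs => rw [h1, norm_smul, Real.norm_eq_abs]
    refine mul_le_mul_of_nonneg_left (((primitiveCLM E).le_opNorm _).trans ?_) (abs_nonneg _)
    exact (mul_le_mul norm_primitiveCLM_le h2 (norm_nonneg _) zero_le_one).trans (one_mul _).le
  have h4 : ‖γ - hφ.path p‖ = 0 := by
    by_contra hne
    have hpos : 0 < ‖γ - hφ.path p‖ := lt_of_le_of_ne (norm_nonneg _) (Ne.symm hne)
    nlinarith
  exact sub_eq_zero.1 (norm_eq_zero.1 h4)

lemma contDiff_integralDefect {n : ℕ} {F : C(E, E)} (hF : ContDiff ℝ n F) :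
    ContDiff ℝ n (integralDefect F) := by
  have h1 : ContDiff ℝ n fun p : (ℝ × E) × C(I, E) => F.comp p.2 :=
    (contDiff_superposition n F hF).comp contDiff_snd
  have h2 : ContDiff ℝ n fun p : (ℝ × E) × C(I, E) => ContinuousMap.const I p.1.2 := by
    let c : E →L[ℝ] C(I, E) := LinearMap.mkContinuous
      { toFun := ContinuousMap.const I, map_add' := fun _ _ => rfl, map_smul' := fun _ _ => rfl }
      1 (fun x => by
        rw [one_mul, ContinuousMap.norm_le _ (norm_nonneg _)]
        exact fun _ => le_rfl)
    exact c.contDiff.comp (contDiff_snd.comp contDiff_fst)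
  exact (contDiff_snd.sub h2).sub ((contDiff_fst.comp contDiff_fst).smul
    ((primitiveCLM E).contDiff.comp h1))

/-- The partial derivative in the path is the identity minus an operator of norm at most |t|K < 1; a
Neumann series inverts it. -/
lemma isInvertible_fderiv_integralDefect [CompleteSpace E] {n : ℕ} (hn : n ≠ 0) {F : C(E, E)}
    (hF : ContDiff ℝ n F) (hL : LipschitzWith K F) {u : (ℝ × E) × C(I, E)}
    (hu : |u.1.1| * K < 1) :
    (fderiv ℝ (integralDefect F) u ∘L .inr ℝ (ℝ × E) C(I, E)).IsInvertible := by
  have hn' : (n : WithTop ℕ∞) ≠ 0 := by exact_mod_cast hn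
  let f' : C(E, E →L[ℝ] E) := ⟨fderiv ℝ F, hF.continuous_fderiv hn'⟩
  have hf' : ∀ x, HasFDerivAt F (f' x) x := fun x => (hF.differentiable hn' x).hasFDerivAt
  set A : C(I, E) →L[ℝ] C(I, E) :=
    u.1.1 • (primitiveCLM E ∘L ContinuousMap.pointwiseCLM (f'.comp u.2)) with hA
  have hAn : ‖A‖ < 1 := by
    have h1 : ‖ContinuousMap.pointwiseCLM (f'.comp u.2)‖ ≤ K := by
      refine (ContinuousMap.norm_pointwiseCLM_apply_le _).trans ?_
      exact (ContinuousMap.norm_le _ K.2).2 fun s => norm_fderiv_le_of_lipschitz ℝ hL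
    refine lt_of_le_of_lt (ContinuousLinearMap.opNorm_le_bound _ (by positivity) fun h => ?_) hu
    change ‖u.1.1 • primitiveCLM E (ContinuousMap.pointwiseCLM (f'.comp u.2) h)‖ ≤ _
    rw [norm_smul, Real.norm_eq_abs, mul_assoc]
    refine mul_le_mul_of_nonneg_left (((primitiveCLM E).le_opNorm _).trans ?_) (abs_nonneg _)
    refine (mul_le_mul norm_primitiveCLM_le (le_refl _) (norm_nonneg _) zero_le_one).trans ?_
    rw [one_mul]
    exact (ContinuousLinearMap.le_opNorm _ h).trans
      (mul_le_mul_of_nonneg_right h1 (norm_nonneg _))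
  have hder : fderiv ℝ (integralDefect F) u ∘L .inr ℝ (ℝ × E) C(I, E)
      = ContinuousLinearMap.id ℝ _ - A := by
    have h1 : HasFDerivAt (fun γ : C(I, E) => integralDefect F (u.1, γ))
        (ContinuousLinearMap.id ℝ _ - A) u.2 := by
      have h2 := ((hasFDerivAt_id u.2).sub_const (ContinuousMap.const I u.1.2)).sub
        (((primitiveCLM E).hasFDerivAt.comp u.2
        (hasFDerivAt_superposition F f' hf' u.2)).const_smul u.1.1)
      exact h2.congr_of_eventuallyEq (Filter.Eventually.of_forall fun _ => rfl)
    have h2 : HasFDerivAt (fun γ : C(I, E) => integralDefect F (u.1, γ))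
        (fderiv ℝ (integralDefect F) u ∘L .inr ℝ (ℝ × E) C(I, E)) u.2 := by
      have := ((contDiff_integralDefect hF).differentiable hn' u).hasFDerivAt
      exact HasFDerivAt.comp u.2 (g := integralDefect F) (f := fun γ => (u.1, γ)) this
        (hasFDerivAt_prodMk_right u.1 u.2)
    exact h2.unique h1
  rw [hder]
  let w := Units.oneSub A hAn
  exact ⟨ContinuousLinearEquiv.ofUnit w, rfl⟩

/-- The implicit function theorem for `integralDefect` gives a C^n family of paths; by uniqueness
these are the orbits, and evaluation at 1 yields the flow. -/
lemma IsGlobalFlow.contDiffAt_of_abs_mul_lt [CompleteSpace E] (hφ : IsGlobalFlow F φ)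
    (hL : LipschitzWith K F) {n : ℕ} (hn : n ≠ 0) (hF : ContDiff ℝ n F) {p : ℝ × E}
    (hp : |p.1| * K < 1) : ContDiffAt ℝ n (Function.uncurry φ) p := by
  have hn' : (n : WithTop ℕ∞) ≠ 0 := by exact_mod_cast hn
  let Fc : C(E, E) := ⟨F, hL.continuous⟩
  have cdf : ContDiffAt ℝ n (integralDefect Fc) (p, hφ.path p) :=
    (contDiff_integralDefect (F := Fc) hF).contDiffAt
  have inv := isInvertible_fderiv_integralDefect (F := Fc) (u := (p, hφ.path p)) hn hF hL hp
  have h1 := cdf.contDiffAt_implicitFunction hn' inv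
  have h2 := cdf.eventually_apply_implicitFunction hn' inv
  have h3 : ∀ᶠ q : ℝ × E in 𝓝 p, |q.1| * K < 1 := by
    have : Continuous fun q : ℝ × E => |q.1| * (K : ℝ) := by fun_prop
    exact (this.tendsto p).eventually (gt_mem_nhds hp)
  let ev : C(I, E) →L[ℝ] E := ContinuousMap.evalCLM ℝ (1 : I)
  have h4 : ContDiffAt ℝ n (fun q => ev (cdf.implicitFunction hn' inv q)) p :=
    h1.continuousLinearMap_comp ev
  refine h4.congr_of_eventuallyEq ?_
  filter_upwards [h2, h3] with q hq hq'
  rw [hφ.integralDefect_path hL.continuous p] at hq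
  have := hφ.eq_path hL hq' hq
  rw [this]
  simp [ev, path, Function.uncurry]

/-- The flow of a Lipschitz vector field of class `C^n` is of class `C^n`. -/
theorem IsGlobalFlow.contDiff [CompleteSpace E] (hφ : IsGlobalFlow F φ)
    (hL : LipschitzWith K F) {n : ℕ} (hn : n ≠ 0) (hF : ContDiff ℝ n F) :
    ContDiff ℝ n (Function.uncurry φ) := by
  -- Doubling the admissible time: φ_t = φ_{t/2} ∘ φ_{t/2}.
  have key : ∀ (m : ℕ) (p : ℝ × E), |p.1| * K < 2 ^ m → ContDiffAt ℝ n (Function.uncurry φ) p := by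
    intro m
    induction m with
    | zero => exact fun p hp => hφ.contDiffAt_of_abs_mul_lt hL hn hF (by simpa using hp)
    | succ m ih =>
      intro p hp
      have hp2 : |p.1 / 2| * K < 2 ^ m := by
        rw [abs_div, abs_two]
        rw [pow_succ] at hp
        linarith
      have heq : Function.uncurry φ = fun q : ℝ × E =>
          Function.uncurry φ (q.1 / 2, Function.uncurry φ (q.1 / 2, q.2)) := by
        ext q
        simp only [Function.uncurry]
        rw [← hφ.add hL, add_halves]
      rw [heq]
      have h1 : ContDiffAt ℝ n (fun q : ℝ × E => (q.1 / 2, q.2)) p := by fun_prop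
      have h2 : ContDiffAt ℝ n (fun q : ℝ × E => Function.uncurry φ (q.1 / 2, q.2)) p :=
        ContDiffAt.comp p (f := fun q : ℝ × E => (q.1 / 2, q.2)) (ih (p.1 / 2, p.2) hp2) h1
      have h3 : ContDiffAt ℝ n (fun q : ℝ × E => q.1 / 2) p := by fun_prop
      exact ContDiffAt.comp p (g := Function.uncurry φ)
        (f := fun q : ℝ × E => (q.1 / 2, Function.uncurry φ (q.1 / 2, q.2)))
        (ih (p.1 / 2, _) hp2) (h3.prodMk h2)
  refine contDiff_iff_contDiffAt.2 fun p => ?_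
  obtain ⟨m, hm⟩ := pow_unbounded_of_one_lt (|p.1| * K) (one_lt_two)
  exact key m p hm

end FlowSmooth

/-! ### C² extension in time -/

section TimeExtension

variable {H G : Type} [NormedAddCommGroup H] [NormedSpace ℝ H]
  [NormedAddCommGroup G] [NormedSpace ℝ G]

/-- Off a closed set every derivative within it is admissible, so at each point the derivatives
within `A` and within `B` combine to one on the union. -/
lemma hasFDerivAt_piecewise_of_isClosed {A B : Set H} [DecidablePred (· ∈ A)] (hA : IsClosed A) (hB : IsClosed B)
    (hAB : A ∪ B = univ) {f g : H → G} {f' g' : H → H →L[ℝ] G}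
    (hfg : ∀ x ∈ A ∩ B, f x = g x) (hfg' : ∀ x ∈ A ∩ B, f' x = g' x)
    (hf : ∀ x ∈ A, HasFDerivWithinAt f (f' x) A x) (hg : ∀ x ∈ B, HasFDerivWithinAt g (g' x) B x)
    (x : H) : HasFDerivAt (A.piecewise f g) (A.piecewise f' g' x) x := by
  have e1 : EqOn (A.piecewise f g) f A := piecewise_eqOn A f g
  have e2 : EqOn (A.piecewise f g) g B := fun z hz => by
    by_cases h : z ∈ A
    · rw [piecewise_eq_of_mem _ _ _ h, hfg z ⟨h, hz⟩]
    · rw [piecewise_eq_of_notMem _ _ _ h]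
  have e2' : EqOn (A.piecewise f' g') g' B := fun z hz => by
    by_cases h : z ∈ A
    · rw [piecewise_eq_of_mem _ _ _ h, hfg' z ⟨h, hz⟩]
    · rw [piecewise_eq_of_notMem _ _ _ h]
  have k1 : HasFDerivWithinAt (A.piecewise f g) (A.piecewise f' g' x) A x := by
    by_cases h : x ∈ A
    · rw [piecewise_eq_of_mem _ _ _ h]
      exact (hf x h).congr e1 (e1 h)
    · exact .of_notMem_closure (by rwa [hA.closure_eq])
  have k2 : HasFDerivWithinAt (A.piecewise f g) (A.piecewise f' g' x) B x := by
    by_cases h : x ∈ B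
    · rw [e2' h]
      exact (hg x h).congr e2 (e2 h)
    · exact .of_notMem_closure (by rwa [hB.closure_eq])
  have := k1.union k2
  rwa [hAB, hasFDerivWithinAt_univ] at this

lemma continuous_piecewise_of_isClosed {X Y : Type} [TopologicalSpace X] [TopologicalSpace Y]
    {A B : Set X} [DecidablePred (· ∈ A)] (hA : IsClosed A) (hB : IsClosed B) (hAB : A ∪ B = univ) {f g : X → Y}
    (hfg : ∀ x ∈ A ∩ B, f x = g x) (hf : ContinuousOn f A) (hg : ContinuousOn g B) :
    Continuous (A.piecewise f g) := by
  rw [← continuousOn_univ, ← hAB]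
  refine ContinuousOn.union_of_isClosed (hf.congr (piecewise_eqOn A f g)) (hg.congr ?_) hA hB
  intro z hz
  by_cases h : z ∈ A
  · rw [piecewise_eq_of_mem _ _ _ h, hfg z ⟨h, hz⟩]
  · rw [piecewise_eq_of_notMem _ _ _ h]

open Classical in
lemma exists_contDiff_two_of_isClosed_union {A B : Set H} (hA : IsClosed A) (hB : IsClosed B)
    (hAB : A ∪ B = univ) {f g : H → G} {f₁ g₁ : H → H →L[ℝ] G} {f₂ g₂ : H → H →L[ℝ] H →L[ℝ] G}
    (m0 : ∀ x ∈ A ∩ B, f x = g x) (m1 : ∀ x ∈ A ∩ B, f₁ x = g₁ x) (m2 : ∀ x ∈ A ∩ B, f₂ x = g₂ x)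
    (hf : ∀ x ∈ A, HasFDerivWithinAt f (f₁ x) A x) (hg : ∀ x ∈ B, HasFDerivWithinAt g (g₁ x) B x)
    (hf₁ : ∀ x ∈ A, HasFDerivWithinAt f₁ (f₂ x) A x)
    (hg₁ : ∀ x ∈ B, HasFDerivWithinAt g₁ (g₂ x) B x)
    (hf₂ : ContinuousOn f₂ A) (hg₂ : ContinuousOn g₂ B) :
    ∃ h : H → G, ContDiff ℝ 2 h ∧ EqOn h f A := by
  have p1 := hasFDerivAt_piecewise_of_isClosed hA hB hAB m0 m1 hf hg
  have p2 := hasFDerivAt_piecewise_of_isClosed hA hB hAB m1 m2 hf₁ hg₁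
  have p3 : Continuous (A.piecewise f₂ g₂) :=
    continuous_piecewise_of_isClosed hA hB hAB m2 hf₂ hg₂
  refine ⟨A.piecewise f g, ?_, piecewise_eqOn A f g⟩
  have : ContDiff ℝ ((1 : ℕ) + 1) (A.piecewise f g) :=
    contDiff_succ_iff_hasFDerivAt.2 ⟨_, by
      rw [Nat.cast_one]
      exact contDiff_one_iff_hasFDerivAt.2 ⟨_, p3, p2⟩, p1⟩
  have h12 : ((1 : ℕ) + 1 : WithTop ℕ∞) = 2 := by norm_num
  rwa [h12] at this

lemma hasFDerivWithinAt_smul_sub_smul_add_smul {s : Set H} {x : H} {u v w : H → G}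
    {u' v' w' : H →L[ℝ] G} (hu : HasFDerivWithinAt u u' s x) (hv : HasFDerivWithinAt v v' s x)
    (hw : HasFDerivWithinAt w w' s x) (a b c : ℝ) :
    HasFDerivWithinAt (fun x => a • u x - b • v x + c • w x) (a • u' - b • v' + c • w') s x :=
  ((hu.const_smul a).sub (hv.const_smul b)).add (hw.const_smul c)

lemma contDiffOn_smul_sub_smul_add_smul {s : Set H} {n : WithTop ℕ∞}
    {u v w : H → G} (hu : ContDiffOn ℝ n u s) (hv : ContDiffOn ℝ n v s) (hw : ContDiffOn ℝ n w s)
    (a b c : ℝ) : ContDiffOn ℝ n (fun x => a • u x - b • v x + c • w x) s := by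
  fun_prop

variable {E : Type} [NormedAddCommGroup E] [NormedSpace ℝ E]

/-- The map `(t, x) ↦ (-k t, x)`. -/
noncomputable def timeReflection (E : Type) [NormedAddCommGroup E] [NormedSpace ℝ E] (k : ℝ) :
    ℝ × E →L[ℝ] ℝ × E :=
  ((-k) • ContinuousLinearMap.fst ℝ ℝ E).prod (ContinuousLinearMap.snd ℝ ℝ E)

@[simp] lemma timeReflection_apply (k : ℝ) (z : ℝ × E) :
    timeReflection E k z = (-k * z.1, z.2) := rfl

lemma timeReflection_split (k : ℝ) (v : ℝ × E) :
    timeReflection E k v = (0, v.2) - k • (v.1, 0) := by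
  ext <;> simp

/-- The weights c = (6, -8, 3) for k = 1, 2, 3 satisfy Σ c_k (-k)^j = 1 for j = 0, 1, 2. The cases j
= 0, 1 match first derivatives here; j = 2 is needed for second derivatives. -/
lemma eq_combination_comp_timeReflection (D : ℝ × E →L[ℝ] G) :
    D = (6 : ℝ) • D.comp (timeReflection E 1) - (8 : ℝ) • D.comp (timeReflection E 2)
      + (3 : ℝ) • D.comp (timeReflection E 3) := by
  refine ContinuousLinearMap.ext fun v => ?_
  have hv : v = (0, v.2) + (v.1, 0) := by ext <;> simp
  simp only [add_apply, sub_apply, smul_apply, ContinuousLinearMap.comp_apply,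
    timeReflection_split, map_sub, map_smul]
  conv_lhs => rw [hv, map_add]
  module

/-- The second derivative of the composition of a map, with second derivative `D`, with
`timeReflection E k`. -/
noncomputable def secondDerivReflection (k : ℝ) (D : ℝ × E →L[ℝ] ℝ × E →L[ℝ] G) :
    ℝ × E →L[ℝ] ℝ × E →L[ℝ] G :=
  ((ContinuousLinearMap.compL ℝ (ℝ × E) (ℝ × E) G).flip (timeReflection E k)).comp
    (D.comp (timeReflection E k))

lemma eq_combination_secondDerivReflection (D : ℝ × E →L[ℝ] ℝ × E →L[ℝ] G) :
    D = (6 : ℝ) • secondDerivReflection 1 D - (8 : ℝ) • secondDerivReflection 2 D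
      + (3 : ℝ) • secondDerivReflection 3 D := by
  refine ContinuousLinearMap.ext fun v => ContinuousLinearMap.ext fun w => ?_
  have hv : ∀ v : ℝ × E, v = (0, v.2) + (v.1, 0) := fun v => by ext <;> simp
  simp only [secondDerivReflection, add_apply, sub_apply, smul_apply,
    ContinuousLinearMap.comp_apply, ContinuousLinearMap.flip_apply,
    ContinuousLinearMap.compL_apply, timeReflection_split, map_sub, map_smul]
  conv_lhs => rw [hv v, hv w, map_add, map_add, add_apply, add_apply]
  module

lemma hasFDerivWithinAt_comp_timeReflection {A B : Set (ℝ × E)} {f₁ : ℝ × E → ℝ × E →L[ℝ] G}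
    {D : ℝ × E →L[ℝ] ℝ × E →L[ℝ] G} {k : ℝ} {z : ℝ × E} (hAB : MapsTo (timeReflection E k) B A)
    (h : HasFDerivWithinAt f₁ D A (timeReflection E k z)) :
    HasFDerivWithinAt (fun z => (f₁ (timeReflection E k z)).comp (timeReflection E k))
      (secondDerivReflection k D) B z := by
  have h1 : HasFDerivWithinAt (fun z => f₁ (timeReflection E k z)) (D.comp (timeReflection E k))
    B z := h.comp z (timeReflection E k).hasFDerivWithinAt hAB
  exact ((ContinuousLinearMap.compL ℝ (ℝ × E) (ℝ × E) G).flip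
      (timeReflection E k)).hasFDerivAt.comp_hasFDerivWithinAt z h1

/-- Higher-order reflection: for t < 0 use 6f(-t) - 8f(-2t) + 3f(-3t), whose derivatives up to order
two agree with those of f at t = 0. -/
theorem exists_contDiff_two_extension_Ici {f : ℝ × E → G}
    (hf : ContDiffOn ℝ 2 f (Ici 0 ×ˢ univ)) :
    ∃ g : ℝ × E → G, ContDiff ℝ 2 g ∧ ∀ z : ℝ × E, 0 ≤ z.1 → g z = f z := by
  set A : Set (ℝ × E) := Ici 0 ×ˢ univ
  set B : Set (ℝ × E) := Iic 0 ×ˢ univ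
  have hA : IsClosed A := isClosed_Ici.prod isClosed_univ
  have hB : IsClosed B := isClosed_Iic.prod isClosed_univ
  have hAB : A ∪ B = univ := by
    ext z; simp [A, B, le_total]
  have huA : UniqueDiffOn ℝ A := (uniqueDiffOn_Ici 0).prod uniqueDiffOn_univ
  have h2 : ContDiffOn ℝ 1 (fderivWithin ℝ f A) A := hf.fderivWithin huA (by norm_num)
  set f₁ := fderivWithin ℝ f A
  set f₂ := fderivWithin ℝ f₁ A
  have d1 : ∀ z ∈ A, HasFDerivWithinAt f (f₁ z) A z := fun z hz =>
    (hf.differentiableOn (by norm_num) z hz).hasFDerivWithinAt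
  have d2 : ∀ z ∈ A, HasFDerivWithinAt f₁ (f₂ z) A z := fun z hz =>
    (h2.differentiableOn (by norm_num) z hz).hasFDerivWithinAt
  have c2 : ContinuousOn f₂ A := h2.continuousOn_fderivWithin huA (by norm_num)
  have hmaps : ∀ k : ℝ, 0 ≤ k → MapsTo (timeReflection E k) B A := fun k hk z hz => by
    have : z.1 ≤ 0 := hz.1
    exact ⟨by simp only [timeReflection_apply, mem_Ici]; nlinarith, trivial⟩
  -- the first and second derivatives of `f ∘ timeReflection k`
  let r₁ : ℝ → ℝ × E → (ℝ × E →L[ℝ] G) := fun k z =>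
    (f₁ (timeReflection E k z)).comp (timeReflection E k)
  let r₂ : ℝ → ℝ × E → (ℝ × E →L[ℝ] ℝ × E →L[ℝ] G) := fun k z =>
    secondDerivReflection k (f₂ (timeReflection E k z))
  have e1 : ∀ k : ℝ, 0 ≤ k → ∀ z ∈ B,
      HasFDerivWithinAt (fun z => f (timeReflection E k z)) (r₁ k z) B z := fun k hk z hz =>
    (d1 _ (hmaps k hk hz)).comp z (timeReflection E k).hasFDerivWithinAt (hmaps k hk)
  have e2 : ∀ k : ℝ, 0 ≤ k → ∀ z ∈ B, HasFDerivWithinAt (r₁ k) (r₂ k z) B z := fun k hk z hz =>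
    hasFDerivWithinAt_comp_timeReflection (hmaps k hk) (d2 _ (hmaps k hk hz))
  have e3 : ∀ k : ℝ, 0 ≤ k → ContDiffOn ℝ 1 (r₁ k) B := fun k hk =>
    (h2.comp (timeReflection E k).contDiff.contDiffOn (hmaps k hk)).clm_comp contDiffOn_const
  let g : ℝ × E → G := fun z => (6 : ℝ) • f (timeReflection E 1 z)
    - (8 : ℝ) • f (timeReflection E 2 z) + (3 : ℝ) • f (timeReflection E 3 z)
  let g₁ : ℝ × E → (ℝ × E →L[ℝ] G) := fun z => (6 : ℝ) • r₁ 1 z - (8 : ℝ) • r₁ 2 z + (3 : ℝ) • r₁ 3 z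
  let g₂ : ℝ × E → (ℝ × E →L[ℝ] ℝ × E →L[ℝ] G) := fun z =>
    (6 : ℝ) • r₂ 1 z - (8 : ℝ) • r₂ 2 z + (3 : ℝ) • r₂ 3 z
  have hzero : ∀ z ∈ A ∩ B, z.1 = 0 := fun z hz => le_antisymm hz.2.1 hz.1.1
  have hfix : ∀ z ∈ A ∩ B, ∀ k, timeReflection E k z = z := fun z hz k => by
    ext <;> simp [hzero z hz]
  have m0 : ∀ z ∈ A ∩ B, f z = g z := fun z hz => by
    simp only [g, hfix z hz]
    module
  have m1 : ∀ z ∈ A ∩ B, f₁ z = g₁ z := fun z hz => by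
    simp only [g₁, r₁]
    rw [hfix z hz, hfix z hz, hfix z hz]
    exact eq_combination_comp_timeReflection _
  have m2 : ∀ z ∈ A ∩ B, f₂ z = g₂ z := fun z hz => by
    simp only [g₂, r₂]
    rw [hfix z hz, hfix z hz, hfix z hz]
    exact eq_combination_secondDerivReflection _
  have q1 : ∀ z ∈ B, HasFDerivWithinAt g (g₁ z) B z := fun z hz =>
    hasFDerivWithinAt_smul_sub_smul_add_smul (e1 1 (by norm_num) z hz)
      (e1 2 (by norm_num) z hz) (e1 3 (by norm_num) z hz) 6 8 3
  have q2 : ∀ z ∈ B, HasFDerivWithinAt g₁ (g₂ z) B z := fun z hz =>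
    hasFDerivWithinAt_smul_sub_smul_add_smul (e2 1 (by norm_num) z hz)
      (e2 2 (by norm_num) z hz) (e2 3 (by norm_num) z hz) 6 8 3
  have huB : UniqueDiffOn ℝ B := (uniqueDiffOn_Iic 0).prod uniqueDiffOn_univ
  have q3 : ContDiffOn ℝ 1 g₁ B := contDiffOn_smul_sub_smul_add_smul (e3 1 (by norm_num))
    (e3 2 (by norm_num)) (e3 3 (by norm_num)) 6 8 3
  have q4 : ContinuousOn g₂ B := (q3.continuousOn_fderivWithin huB (by norm_num)).congr
    fun z hz => ((q2 z hz).fderivWithin (huB z hz)).symm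
  obtain ⟨h, h1, h3⟩ := exists_contDiff_two_of_isClosed_union hA hB hAB m0 m1 m2 d1 q1 d2 q2 c2 q4
  exact ⟨h, h1, fun z hz => h3 ⟨hz, trivial⟩⟩

lemma exists_contDiff_two_extension_cutoff {T : ℝ} (hT : 0 < T) {f : ℝ × E → G}
    (hf : ContDiffOn ℝ 2 f (Icc 0 T ×ˢ univ)) {β : ℝ → ℝ} (hβ : ContDiff ℝ 2 β)
    (hβ0 : ∀ t, 2 * T / 3 ≤ t → β t = 0) :
    ∃ g : ℝ × E → G, ContDiff ℝ 2 g ∧ ∀ z : ℝ × E, z.1 ∈ Icc 0 T → g z = β z.1 • f z := by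
  obtain ⟨g, h1, h2⟩ := exists_contDiff_two_extension_Ici (f := fun z : ℝ × E => β z.1 • f z) (by
    intro z hz
    rcases lt_or_ge z.1 T with h | h
    · have : ContDiffWithinAt ℝ 2 (fun z : ℝ × E => β z.1 • f z) (Icc 0 T ×ˢ univ) z :=
        (hβ.comp contDiff_fst).contDiffWithinAt.smul (hf z ⟨⟨hz.1, h.le⟩, trivial⟩)
      refine this.mono_of_mem_nhdsWithin ?_
      have hn : {w : ℝ × E | w.1 < T} ∈ 𝓝 z :=
        (isOpen_lt continuous_fst continuous_const).mem_nhds h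
      filter_upwards [self_mem_nhdsWithin, mem_nhdsWithin_of_mem_nhds hn] with w hw hw'
      exact ⟨⟨hw.1, le_of_lt hw'⟩, trivial⟩
    · have hn : {w : ℝ × E | 2 * T / 3 < w.1} ∈ 𝓝 z :=
        (isOpen_lt continuous_const continuous_fst).mem_nhds (by
          change 2 * T / 3 < z.1; linarith)
      have : ContDiffAt ℝ 2 (fun z : ℝ × E => β z.1 • f z) z := by
        refine (contDiffAt_const (c := (0 : G))).congr_of_eventuallyEq ?_
        filter_upwards [hn] with w hw
        rw [hβ0 _ (le_of_lt hw), zero_smul]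
      exact this.contDiffWithinAt)
  exact ⟨g, h1, fun z hz => h2 z hz.1⟩

/-- A `C²` function on `[0,T] × E` extends to a `C²` function on `ℝ × E`. -/
theorem exists_contDiff_two_extension_Icc {T : ℝ} (hT : 0 < T) {f : ℝ × E → G}
    (hf : ContDiffOn ℝ 2 f (Icc 0 T ×ˢ univ)) :
    ∃ g : ℝ × E → G, ContDiff ℝ 2 g ∧ ∀ z : ℝ × E, z.1 ∈ Icc 0 T → g z = f z := by
  -- The cutoff is 1 up to T/3 and 0 from 2T/3 on. Then αf is extended past 0, and (1-α)f past T
  -- after the reversal t ↦ T - t.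
  let α : ℝ → ℝ := fun t => Real.smoothTransition (2 - 3 * t / T)
  have hα : ContDiff ℝ 2 α := Real.smoothTransition.contDiff.comp (by fun_prop)
  have hα0 : ∀ t, 2 * T / 3 ≤ t → α t = 0 := fun t ht =>
    Real.smoothTransition.zero_of_nonpos (by
      have : 2 ≤ 3 * t / T := by rw [le_div_iff₀ hT]; linarith
      linarith)
  have hα1 : ∀ t, t ≤ T / 3 → α t = 1 := fun t ht =>
    Real.smoothTransition.one_of_one_le (by
      have : 3 * t / T ≤ 1 := by rw [div_le_iff₀ hT]; linarith
      linarith)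
  let R : ℝ × E → ℝ × E := fun z => (T - z.1, z.2)
  have hR : ContDiff ℝ 2 R := by fun_prop
  obtain ⟨g₁, h1, h1'⟩ := exists_contDiff_two_extension_cutoff hT hf hα hα0
  obtain ⟨g₂, h2, h2'⟩ := exists_contDiff_two_extension_cutoff hT (f := fun z => f (R z))
    (hf.comp hR.contDiffOn (fun z hz => ⟨⟨by simp only [R]; linarith [hz.1.2],
      by simp only [R]; linarith [hz.1.1]⟩, trivial⟩))
    (β := fun t => 1 - α (T - t)) (by fun_prop) (fun t ht => by
      rw [hα1 _ (by linarith), sub_self])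
  refine ⟨fun z => g₁ z + g₂ (R z), h1.add (h2.comp hR), fun z hz => ?_⟩
  dsimp only
  rw [h1' z hz, h2' (R z) ⟨by simp only [R]; linarith [hz.2], by simp only [R]; linarith [hz.1]⟩]
  simp only [R, sub_sub_cancel]
  module

end TimeExtension

/-! ### Global defining functions of smooth domains -/

section DefiningFunction

/-- `ρ` is a global defining function of class `C^n` of the set `Ω`. -/
structure IsGlobalDefiningFunction (n : WithTop ℕ∞) (Ω : Set Plane) (ρ : Plane → ℝ) : Prop where
  contDiff : ContDiff ℝ n ρ
  mem_iff : ∀ z, z ∈ Ω ↔ ρ z < 0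
  mem_frontier_iff : ∀ z, z ∈ frontier Ω ↔ ρ z = 0
  fderiv_ne : ∀ z ∈ frontier Ω, fderiv ℝ ρ z ≠ 0

lemma gradient_ne_zero_iff {f : Plane → ℝ} {x : Plane} : gradient f x ≠ 0 ↔ fderiv ℝ f x ≠ 0 := by
  rw [← toDual_gradient, Ne, Ne, map_eq_zero_iff _ (LinearIsometryEquiv.injective _)]

lemma IsGlobalDefiningFunction.isDefiningFunctionAt {n : WithTop ℕ∞} {Ω : Set Plane}
    {ρ : Plane → ℝ} (h : IsGlobalDefiningFunction n Ω ρ) {m : WithTop ℕ∞} (hm : m ≤ n) {x : Plane}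
    (hx : x ∈ frontier Ω) : IsDefiningFunctionAt m Ω x ρ :=
  ⟨h.contDiff.of_le hm, gradient_ne_zero_iff.2 (h.fderiv_ne x hx),
    Filter.Eventually.of_forall h.mem_iff⟩

lemma IsGlobalDefiningFunction.mem_closure_iff {n : WithTop ℕ∞} {Ω : Set Plane}
    {ρ : Plane → ℝ} (h : IsGlobalDefiningFunction n Ω ρ) {x : Plane} :
    x ∈ closure Ω ↔ ρ x ≤ 0 := by
  rw [closure_eq_self_union_frontier, mem_union, h.mem_iff, h.mem_frontier_iff, le_iff_lt_or_eq]

lemma IsGlobalDefiningFunction.isOpen {n : WithTop ℕ∞} {Ω : Set Plane}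
    {ρ : Plane → ℝ} (h : IsGlobalDefiningFunction n Ω ρ) : IsOpen Ω := by
  have : Ω = {x | ρ x < 0} := by ext x; exact h.mem_iff x
  rw [this]
  exact isOpen_lt h.contDiff.continuous continuous_const

/-- A function which is negative to the right of a zero has nonpositive derivative there. -/
lemma fderiv_apply_nonpos_of_eventually {ρ : Plane → ℝ} {z v : Plane} (hρ : DifferentiableAt ℝ ρ z)
    (h0 : ρ z = 0) (h : ∀ᶠ t : ℝ in 𝓝[>] 0, ρ (z + t • v) ≤ 0) : fderiv ℝ ρ z v ≤ 0 := by
  have hd : HasDerivAt (fun t : ℝ => ρ (z + t • v)) (fderiv ℝ ρ z v) 0 :=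
    hρ.hasFDerivAt.hasLineDerivAt v
  have hs := hd.tendsto_slope_zero_right
  refine le_of_tendsto hs ?_
  filter_upwards [h, self_mem_nhdsWithin] with t ht ht0
  have : (0 : ℝ) < t := ht0
  simp only [zero_add, zero_smul, add_zero, h0, sub_zero, smul_eq_mul]
  exact mul_nonpos_of_nonneg_of_nonpos (by positivity) ht

lemma eventually_neg_of_fderiv_neg {ρ : Plane → ℝ} {z v : Plane} (hρ : DifferentiableAt ℝ ρ z)
    (h0 : ρ z = 0) (h : fderiv ℝ ρ z v < 0) : ∀ᶠ t : ℝ in 𝓝[>] 0, ρ (z + t • v) < 0 := by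
  have hd : HasDerivAt (fun t : ℝ => ρ (z + t • v)) (fderiv ℝ ρ z v) 0 :=
    hρ.hasFDerivAt.hasLineDerivAt v
  have hs := hd.tendsto_slope_zero_right
  filter_upwards [hs.eventually (gt_mem_nhds h), self_mem_nhdsWithin] with t ht ht0
  have ht0' : (0 : ℝ) < t := ht0
  simp only [zero_add, zero_smul, add_zero, h0, sub_zero, smul_eq_mul] at ht
  by_contra hcon
  push Not at hcon
  have : 0 ≤ t⁻¹ * ρ (z + t • v) := by positivity
  linarith

/-- A bounded domain of class `C^∞` has a global defining function. -/
theorem IsBoundedDomainOfClass.exists_globalDefiningFunction {Ω : Set Plane}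
    (hΩ : IsBoundedDomainOfClass ((⊤ : ℕ∞) : WithTop ℕ∞) Ω) :
    ∃ ρ, IsGlobalDefiningFunction ((⊤ : ℕ∞) : WithTop ℕ∞) Ω ρ := by
  have hopen : IsOpen Ω := hΩ.isDomain.1
  have hne : ((⊤ : ℕ∞) : WithTop ℕ∞) ≠ 0 := by simp
  have hdisj : ∀ z ∈ frontier Ω, z ∉ Ω := fun z hz hz' => by
    rw [hopen.frontier_eq] at hz; exact hz.2 hz'
  -- a good ball around each boundary point
  have hloc : ∀ x : frontier Ω, ∃ (ρ : Plane → ℝ) (r : ℝ), 0 < r ∧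
      ContDiff ℝ ((⊤ : ℕ∞) : WithTop ℕ∞) ρ ∧ ∀ z ∈ Metric.ball (x : Plane) r,
        (z ∈ Ω ↔ ρ z < 0) ∧ fderiv ℝ ρ z ≠ 0 := by
    intro x
    obtain ⟨ρ, h1, h2, h3⟩ := hΩ.boundary x x.2
    have h4 : ∀ᶠ z in 𝓝 (x : Plane), fderiv ℝ ρ z ≠ 0 :=
      (h1.continuous_fderiv hne).continuousAt.eventually_ne (gradient_ne_zero_iff.1 h2)
    obtain ⟨r, hr, h5⟩ := Metric.eventually_nhds_iff_ball.1 (h3.and h4)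
    exact ⟨ρ, r, hr, h1, h5⟩
  choose ρ r hr hρ hball using hloc
  have hzero : ∀ (x : frontier Ω), ∀ z ∈ Metric.ball (x : Plane) (r x), z ∈ frontier Ω →
      ρ x z = 0 := by
    intro x z hz hzf
    refine le_antisymm ?_ (not_lt.1 fun h => hdisj z hzf (((hball x z hz).1).2 h))
    by_contra hcon
    push Not at hcon
    have h1 : ∀ᶠ w in 𝓝 z, 0 < ρ x w := (hρ x).continuous.continuousAt.eventually (lt_mem_nhds hcon)
    have h2 := (h1.and (Metric.isOpen_ball.mem_nhds hz)).and_frequently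
      (mem_closure_iff_frequently.1 (frontier_subset_closure hzf))
    obtain ⟨w, ⟨h3, h4⟩, h5⟩ := h2.exists
    exact absurd (((hball x w h4).1).1 h5) (not_lt.2 h3.le)
  have hcpt : IsCompact (frontier Ω) :=
    Metric.isCompact_of_isClosed_isBounded isClosed_frontier
      (hΩ.isBounded.closure.subset frontier_subset_closure)
  let χ : ∀ x : frontier Ω, ContDiffBump (x : Plane) := fun x =>
    ⟨r x / 2, r x, half_pos (hr x), half_lt_self (hr x)⟩
  obtain ⟨s, hs⟩ := hcpt.elim_finite_subcover (fun x : frontier Ω => Metric.ball (x : Plane) (r x))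
    (fun _ => Metric.isOpen_ball) fun x hx =>
      mem_iUnion.2 ⟨⟨x, hx⟩, Metric.mem_ball_self (hr _)⟩
  obtain ⟨a, ha, ha1, ha2⟩ := hopen.exists_contDiff_support_eq (n := ⊤)
  obtain ⟨b, hb, hb1, hb2⟩ := (isClosed_closure (s := Ω)).isOpen_compl.exists_contDiff_support_eq
    (n := ⊤)
  have hχ : ∀ x z, 0 < χ x z → z ∈ Metric.ball (x : Plane) (r x) := fun x z h => by
    have : z ∈ Function.support (χ x) := h.ne'
    rwa [(χ x).support_eq] at this
  have ha0 : ∀ z, 0 ≤ a z := fun z => (ha2 ⟨z, rfl⟩).1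
  have hb0 : ∀ z, 0 ≤ b z := fun z => (hb2 ⟨z, rfl⟩).1
  have hapos : ∀ z, a z ≠ 0 ↔ z ∈ Ω := fun z => by rw [← ha]; rfl
  have hbpos : ∀ z, b z ≠ 0 ↔ z ∉ closure Ω := fun z => by rw [← mem_compl_iff, ← hb]; rfl
  -- Local defining functions share their sign, so their weighted sum has the right weak sign
  -- everywhere; `a`, positive exactly in Ω, and `b`, positive exactly off the closure, make the
  -- sign strict.
  let R : Plane → ℝ := fun z => (∑ x ∈ s, χ x z * ρ x z) - a z + b z
  have hR : ContDiff ℝ ((⊤ : ℕ∞) : WithTop ℕ∞) R := by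
    refine ((ContDiff.sum fun x _ => ?_).sub ha1).add hb1
    exact (χ x).contDiff.mul (hρ x)
  have hin : ∀ z ∈ Ω, R z < 0 := by
    intro z hz
    have h1 : ∑ x ∈ s, χ x z * ρ x z ≤ 0 := by
      refine Finset.sum_nonpos fun x _ => ?_
      rcases (χ x).nonneg.eq_or_lt (b := χ x z) with h | h
      · rw [← h, zero_mul]
      · exact mul_nonpos_of_nonneg_of_nonpos h.le (((hball x z (hχ x z h)).1).1 hz).le
    have h2 : 0 < a z := lt_of_le_of_ne (ha0 z) ((hapos z).2 hz).symm
    have h3 : b z = 0 := not_not.1 fun h => (hbpos z).1 h (subset_closure hz)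
    simp only [R]; linarith
  have hout : ∀ z, z ∉ closure Ω → 0 < R z := by
    intro z hz
    have hz' : z ∉ Ω := fun h => hz (subset_closure h)
    have h1 : 0 ≤ ∑ x ∈ s, χ x z * ρ x z := by
      refine Finset.sum_nonneg fun x _ => ?_
      rcases (χ x).nonneg.eq_or_lt (b := χ x z) with h | h
      · rw [← h, zero_mul]
      · exact mul_nonneg h.le (not_lt.1 fun h' => hz' (((hball x z (hχ x z h)).1).2 h'))
    have h2 : 0 < b z := lt_of_le_of_ne (hb0 z) ((hbpos z).2 hz).symm
    have h3 : a z = 0 := not_not.1 fun h => hz' ((hapos z).1 h)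
    simp only [R]; linarith
  have hafr : ∀ z ∈ frontier Ω, a z = 0 := fun z hz =>
    not_not.1 fun h => hdisj z hz ((hapos z).1 h)
  have hbfr : ∀ z ∈ frontier Ω, b z = 0 := fun z hz =>
    not_not.1 fun h => (hbpos z).1 h (frontier_subset_closure hz)
  have hfr : ∀ z ∈ frontier Ω, R z = 0 := by
    intro z hz
    have h1 : ∑ x ∈ s, χ x z * ρ x z = 0 := by
      refine Finset.sum_eq_zero fun x _ => ?_
      rcases (χ x).nonneg.eq_or_lt (b := χ x z) with h | h
      · rw [← h, zero_mul]
      · rw [hzero x z (hχ x z h) hz, mul_zero]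
    simp only [R, h1, hafr z hz, hbfr z hz]; norm_num
  have htri : ∀ z, z ∈ Ω ∨ z ∈ frontier Ω ∨ z ∉ closure Ω := fun z => by
    by_cases h : z ∈ closure Ω
    · rw [closure_eq_self_union_frontier] at h
      exact h.imp id Or.inl
    · exact .inr (.inr h)
  refine ⟨R, hR, fun z => ⟨hin z, fun h => ?_⟩, fun z => ⟨hfr z, fun h => ?_⟩, fun z hz hcon => ?_⟩
  · rcases htri z with h1 | h1 | h1
    · exact h1
    · linarith [hfr z h1]
    · linarith [hout z h1]
  · rcases htri z with h1 | h1 | h1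
    · linarith [hin z h1]
    · exact h1
    · linarith [hout z h1]
  -- On the boundary `a` and `b` attain their minimum 0, so only the weighted sum contributes to the
  -- derivative.
  · have hda : fderiv ℝ a z = 0 := by
      refine IsLocalMin.fderiv_eq_zero (Filter.Eventually.of_forall fun w => ?_)
      rw [hafr z hz]; exact ha0 w
    have hdb : fderiv ℝ b z = 0 := by
      refine IsLocalMin.fderiv_eq_zero (Filter.Eventually.of_forall fun w => ?_)
      rw [hbfr z hz]; exact hb0 w
    have hdρ : ∀ x, HasFDerivAt (ρ x) (fderiv ℝ (ρ x) z) z := fun x =>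
      ((hρ x).differentiable hne z).hasFDerivAt
    have hterm : ∀ x ∈ s, HasFDerivAt (fun w => χ x w * ρ x w) (χ x z • fderiv ℝ (ρ x) z) z := by
      intro x _
      have hχd : DifferentiableAt ℝ (χ x) z :=
        ((χ x).contDiff (n := ⊤)).differentiable hne z
      have h1 := hχd.hasFDerivAt.mul (hdρ x)
      rcases (χ x).nonneg.eq_or_lt (b := χ x z) with h | h
      · have : fderiv ℝ (χ x) z = 0 :=
          IsLocalMin.fderiv_eq_zero (Filter.Eventually.of_forall fun w => by
            rw [← h]; exact (χ x).nonneg)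
        rwa [this, smul_zero, add_zero] at h1
      · rwa [hzero x z (hχ x z h) hz, zero_smul, add_zero] at h1
    have hRd : HasFDerivAt R (∑ x ∈ s, χ x z • fderiv ℝ (ρ x) z) z := by
      have h1 := ((HasFDerivAt.fun_sum hterm).sub
        (ha1.differentiable hne z).hasFDerivAt).add (hb1.differentiable hne z).hasFDerivAt
      rwa [hda, hdb, sub_zero, add_zero] at h1
    rw [hRd.fderiv] at hcon
    obtain ⟨j, hj, hjz⟩ := mem_iUnion₂.1 (hs hz)
    have hjpos : 0 < χ j z := (χ j).pos_of_mem_ball hjz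
    -- A direction entering Ω according to one `ρ j` is nonincreasing to first order for all the
    -- active ones, so the derivatives cannot cancel.
    obtain ⟨v, hv⟩ : ∃ v, fderiv ℝ (ρ j) z v < 0 := by
      obtain ⟨v, hv⟩ := DFunLike.ne_iff.1 ((hball j z hjz).2)
      rcases lt_or_gt_of_ne hv with h | h
      · exact ⟨v, h⟩
      · exact ⟨-v, by rw [map_neg]; exact neg_neg_of_pos h⟩
    have hcontv : Filter.Tendsto (fun t : ℝ => z + t • v) (𝓝[>] 0) (𝓝 z) := by
      have : Continuous fun t : ℝ => z + t • v := by fun_prop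
      have h := this.tendsto 0
      simp only [zero_smul, add_zero] at h
      exact h.mono_left nhdsWithin_le_nhds
    have hΩev : ∀ᶠ t : ℝ in 𝓝[>] 0, z + t • v ∈ Ω := by
      filter_upwards [eventually_neg_of_fderiv_neg (hdρ j).differentiableAt (hzero j z hjz hz) hv,
        hcontv.eventually (Metric.isOpen_ball.mem_nhds hjz)] with t ht1 ht2
      exact ((hball j _ ht2).1).2 ht1
    have hle : ∀ i ∈ s, χ i z * fderiv ℝ (ρ i) z v ≤ 0 := by
      intro i _
      rcases (χ i).nonneg.eq_or_lt (b := χ i z) with h | h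
      · rw [← h, zero_mul]
      · refine mul_nonpos_of_nonneg_of_nonpos h.le (fderiv_apply_nonpos_of_eventually
          (hdρ i).differentiableAt (hzero i z (hχ i z h) hz) ?_)
        filter_upwards [hΩev, hcontv.eventually (Metric.isOpen_ball.mem_nhds (hχ i z h))]
          with t ht1 ht2
        exact (((hball i _ ht2).1).1 ht1).le
    have h0 : ∑ x ∈ s, χ x z * fderiv ℝ (ρ x) z v = 0 := by
      have := congrArg (fun L : Plane →L[ℝ] ℝ => L v) hcon
      simpa using this
    have := Finset.sum_lt_sum hle ⟨j, hj, mul_neg_of_pos_of_neg hjpos hv⟩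
    simp only [Finset.sum_const_zero] at this
    linarith

end DefiningFunction

/-! ### One-way crossing of zero -/

section Crossing

/-- A function with positive derivative at each of its zeros crosses zero only upwards. -/
theorem pos_of_hasDerivWithinAt_pos_of_eq_zero {g : ℝ → ℝ} {a b : ℝ} (hg : ContinuousOn g (Icc a b))
    (hder : ∀ s ∈ Icc a b, g s = 0 → ∃ g' > 0, HasDerivWithinAt g g' (Icc a b) s)
    (ha : 0 ≤ g a) {s : ℝ} (hs : s ∈ Ioc a b) : 0 < g s := by
  have hab : a < b := hs.1.trans_le hs.2
  have hslope : ∀ u ∈ Icc a b, g u = 0 → ∀ᶠ v in 𝓝[Icc a b \ {u}] u, 0 < (v - u) * g v := by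
    intro u hu hu0
    obtain ⟨g', hg', hd⟩ := hder u hu hu0
    have := (hasDerivWithinAt_iff_tendsto_slope.1 hd).eventually (lt_mem_nhds hg')
    filter_upwards [this, self_mem_nhdsWithin] with v hv hv'
    rw [slope_def_field, hu0, sub_zero, div_pos_iff] at hv
    rcases hv with h | h
    · exact mul_pos h.2 h.1
    · exact mul_pos_of_neg_of_neg h.2 h.1
  -- The first point after `c` where `g ≤ 0` would be a zero reached from positive values, against
  -- the positive slope there.
  have main : ∀ c, a ≤ c → c < s → 0 < g c → 0 < g s := by
    intro c hac hcs hc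
    by_contra hcon
    push Not at hcon
    let S := {v ∈ Icc c s | g v ≤ 0}
    have hcont : ContinuousOn g (Icc c s) := hg.mono (Icc_subset_Icc hac hs.2)
    have hS : IsCompact S := by
      refine isCompact_Icc.of_isClosed_subset ?_ (sep_subset _ _)
      exact hcont.preimage_isClosed_of_isClosed isClosed_Icc isClosed_Iic
    obtain ⟨u, hu, hmin⟩ := hS.exists_isLeast ⟨s, ⟨hcs.le, le_rfl⟩, hcon⟩
    have hcu : c < u := lt_of_le_of_ne hu.1.1 fun h => by rw [← h] at hu; linarith [hu.2]
    have hpos : ∀ v ∈ Ioo c u, 0 < g v := fun v hv => by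
      by_contra h
      push Not at h
      exact absurd (hmin ⟨⟨hv.1.le, hv.2.le.trans hu.1.2⟩, h⟩) (not_le.2 hv.2)
    have hneb : (𝓝[Ioo c u] u).NeBot := right_nhdsWithin_Ioo_neBot hcu
    have hu0 : g u = 0 := by
      refine le_antisymm hu.2 ?_
      have ht : Filter.Tendsto g (𝓝[Ioo c u] u) (𝓝 (g u)) :=
        ((hcont u hu.1).mono fun v hv => ⟨hv.1.le, hv.2.le.trans hu.1.2⟩)
      exact ge_of_tendsto ht (by filter_upwards [self_mem_nhdsWithin] with v hv using (hpos v hv).le)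
    have hev := hslope u ⟨hac.trans hcu.le, hu.1.2.trans hs.2⟩ hu0
    have hle : 𝓝[Ioo c u] u ≤ 𝓝[Icc a b \ {u}] u := nhdsWithin_mono _ fun v hv =>
      ⟨⟨hac.trans hv.1.le, (hv.2.le.trans hu.1.2).trans hs.2⟩, hv.2.ne⟩
    obtain ⟨v, hv1, hv2⟩ := ((hev.filter_mono hle).and self_mem_nhdsWithin).exists
    nlinarith [hpos v hv2, hv2.2]
  rcases ha.eq_or_lt with h | h
  · have hev := hslope a ⟨le_rfl, hab.le⟩ h.symm
    have hneb : (𝓝[Ioo a s] a).NeBot := left_nhdsWithin_Ioo_neBot hs.1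
    have hle : 𝓝[Ioo a s] a ≤ 𝓝[Icc a b \ {a}] a := nhdsWithin_mono _ fun v hv =>
      ⟨⟨hv.1.le, hv.2.le.trans hs.2⟩, hv.1.ne'⟩
    obtain ⟨v, hv1, hv2⟩ := ((hev.filter_mono hle).and self_mem_nhdsWithin).exists
    exact main v hv2.1.le hv2.2 (pos_of_mul_pos_right hv1 (sub_nonneg.2 hv2.1.le))
  · exact main a le_rfl hs.1 h

end Crossing

/-! ### Outward fields and comparison of boundary derivatives -/

section Outflow

variable {Ω : Set Plane} {ρ : Plane → ℝ} {n : WithTop ℕ∞}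

lemma IsGlobalDefiningFunction.differentiable (h : IsGlobalDefiningFunction n Ω ρ) (hn : n ≠ 0) :
    Differentiable ℝ ρ := h.contDiff.differentiable hn

/-- The derivative of a defining function is positive in the directions pointing outwards. -/
lemma IsGlobalDefiningFunction.fderiv_pos_of_outerNormal (h : IsGlobalDefiningFunction n Ω ρ)
    (hn : 1 ≤ n) {x : Plane} (hx : x ∈ frontier Ω) {γ : ℝ} (hγ : 0 < γ) {v : Plane}
    (hv : ∀ ν, IsOuterNormal Ω x ν → γ ≤ inner ℝ v ν) : 0 < fderiv ℝ ρ x v := by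
  have hne := gradient_ne_zero_iff.2 (h.fderiv_ne x hx)
  have hpos : 0 < ‖gradient ρ x‖ := norm_pos_iff.2 hne
  have h1 := hv (‖gradient ρ x‖⁻¹ • gradient ρ x) ⟨by rw [norm_smul, norm_inv, norm_norm]; field_simp,
    ρ, h.isDefiningFunctionAt hn hx, ‖gradient ρ x‖, hpos, by rw [smul_inv_smul₀ hpos.ne']⟩
  rw [real_inner_smul_right, real_inner_comm, inner_gradient_left] at h1
  have h2 : 0 < ‖gradient ρ x‖⁻¹ * fderiv ℝ ρ x v := hγ.trans_le h1
  exact pos_of_mul_pos_right h2 (by positivity)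

/-- If the field `Y` points outwards along the whole boundary, then not every trajectory can leave
the domain. -/
theorem IsGlobalDefiningFunction.not_forall_outgoing (h : IsGlobalDefiningFunction n Ω ρ)
    (hn : n ≠ 0) (hne : Ω.Nonempty) {T : ℝ} (hT : 0 < T) {Y : ℝ → Plane → Plane}
    (hY : ContDiffOn ℝ 2 (Function.uncurry Y) (Icc 0 T ×ˢ (univ : Set Plane)))
    {X : ℝ → ℝ → Plane → Plane} (hX : IsFlow T Y X) (hout : closure Ω = outgoingSet Ω T X)
    (hpos : ∀ t ∈ Icc 0 T, ∀ x ∈ frontier Ω, 0 < fderiv ℝ ρ x (Y t x)) : False := by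
  obtain ⟨z, hz⟩ := hne
  have hTm : T ∈ Icc 0 T := ⟨hT.le, le_rfl⟩
  have h0m : (0 : ℝ) ∈ Icc 0 T := ⟨le_rfl, hT.le⟩
  obtain ⟨hXT, hXd⟩ := hX T hTm z
  have hgd : ∀ s ∈ Icc 0 T, HasDerivWithinAt (fun s => ρ (X s T z))
      (fderiv ℝ ρ (X s T z) (Y s (X s T z))) (Icc 0 T) s := fun s hs =>
    (h.differentiable hn _).hasFDerivAt.comp_hasDerivWithinAt s (hXd s hs)
  -- The trajectory ending at `z` at time `T` has never been outside Ω, because once outside or on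
  -- the boundary it could not come back.
  have hneg : ∀ s ∈ Icc 0 T, ρ (X s T z) < 0 := by
    intro s hs
    by_contra hcon
    push Not at hcon
    have hzT : ρ (X T T z) < 0 := by rw [hXT]; exact (h.mem_iff z).1 hz
    have hsT : s < T := lt_of_le_of_ne hs.2 fun e => by rw [e] at hcon; linarith
    have hsub : Icc s T ⊆ Icc 0 T := Icc_subset_Icc_left hs.1
    have := pos_of_hasDerivWithinAt_pos_of_eq_zero (g := fun s => ρ (X s T z)) (a := s) (b := T)
      (fun u hu => ((hgd u (hsub hu)).mono hsub).continuousWithinAt)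
      (fun u hu hu0 => ⟨_, hpos u (hsub hu) _ ((h.mem_frontier_iff _).2 hu0),
        (hgd u (hsub hu)).mono hsub⟩) hcon ⟨hsT, le_rfl⟩
    linarith
  set x := X 0 T z with hx
  have hxcl : x ∈ closure Ω := subset_closure ((h.mem_iff _).2 (hneg 0 h0m))
  rw [hout] at hxcl
  obtain ⟨-, t, ht, htX⟩ := hxcl
  obtain ⟨hX0, hXd0⟩ := hX 0 h0m x
  have c1 : ContinuousOn (fun s => X s T z) (Icc 0 T) := fun s hs => (hXd s hs).continuousWithinAt
  have c2 : ContinuousOn (fun s => X s 0 x) (Icc 0 T) := fun s hs => (hXd0 s hs).continuousWithinAt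
  -- `Y` is Lipschitz in space only on bounded sets; a ball containing both trajectories suffices
  -- for uniqueness.
  obtain ⟨R, hR⟩ := ((isCompact_Icc.image_of_continuousOn c1).union
    (isCompact_Icc.image_of_continuousOn c2)).isBounded.subset_closedBall 0
  obtain ⟨K, hK⟩ := (hY.mono (t := Icc 0 T ×ˢ Metric.closedBall (0 : Plane) R)
    (prod_mono_right (subset_univ _))).exists_lipschitzOnWith (by norm_num)
    ((convex_Icc 0 T).prod (convex_closedBall _ _)) (isCompact_Icc.prod (isCompact_closedBall _ _))
  have huniq := ODE_solution_unique_of_mem_Icc_right (v := Y) (K := K)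
    (s := fun _ => Metric.closedBall (0 : Plane) R) (f := fun s => X s T z) (g := fun s => X s 0 x)
    (a := 0) (b := T) (fun s hs => by
      intro p hp q hq
      have := hK (x := (s, p)) ⟨Ico_subset_Icc_self hs, hp⟩ (y := (s, q)) ⟨Ico_subset_Icc_self hs, hq⟩
      simpa [Function.uncurry, Prod.edist_eq] using this)
    c1 (fun s hs => (hXd s (Ico_subset_Icc_self hs)).mono_of_mem_nhdsWithin
      (Icc_mem_nhdsGE_of_mem hs))
    (fun s hs => hR (.inl ⟨s, Ico_subset_Icc_self hs, rfl⟩))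
    c2 (fun s hs => (hXd0 s (Ico_subset_Icc_self hs)).mono_of_mem_nhdsWithin
      (Icc_mem_nhdsGE_of_mem hs))
    (fun s hs => hR (.inr ⟨s, Ico_subset_Icc_self hs, rfl⟩)) hX0.symm
  have hts := Ioo_subset_Icc_self ht
  have := huniq hts
  simp only at this
  rw [← this] at htX
  exact htX (subset_closure ((h.mem_iff _).2 (hneg t hts)))

/-- At a common boundary point, a defining function of a larger set is negative to first order
in the directions in which the one of the smaller set is. -/
lemma IsGlobalDefiningFunction.fderiv_neg_of_subset {m : WithTop ℕ∞} {O : Set Plane} {r : Plane → ℝ}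
    (hρ : IsGlobalDefiningFunction n Ω ρ) (hr : IsGlobalDefiningFunction m O r) (hn : n ≠ 0)
    (hm : m ≠ 0) (hsub : Ω ⊆ O) {x : Plane} (hx : x ∈ frontier Ω) (hx' : x ∈ frontier O) {v : Plane}
    (hv : fderiv ℝ ρ x v < 0) : fderiv ℝ r x v < 0 := by
  have hle : ∀ v, fderiv ℝ ρ x v < 0 → fderiv ℝ r x v ≤ 0 := fun v hv =>
    fderiv_apply_nonpos_of_eventually (hr.differentiable hm x) ((hr.mem_frontier_iff x).1 hx') (by
      filter_upwards [eventually_neg_of_fderiv_neg (hρ.differentiable hn x)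
        ((hρ.mem_frontier_iff x).1 hx) hv] with t ht
      exact ((hr.mem_iff _).1 (hsub ((hρ.mem_iff _).2 ht))).le)
  -- Inclusion yields only a weak inequality. Since it also holds for `v + ε • w` with small ε > 0,
  -- and `r` increases along `w`, it is strict at `v`.
  obtain ⟨w, hw⟩ : ∃ w, 0 < fderiv ℝ r x w := by
    obtain ⟨v, hv⟩ := DFunLike.ne_iff.1 (hr.fderiv_ne x hx')
    rcases lt_or_gt_of_ne hv with h | h
    · exact ⟨-v, by rw [map_neg]; exact neg_pos_of_neg h⟩
    · exact ⟨v, h⟩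
  have hcont : Continuous fun ε : ℝ => fderiv ℝ ρ x v + ε * fderiv ℝ ρ x w := by fun_prop
  have hev : ∀ᶠ ε : ℝ in 𝓝[>] 0, fderiv ℝ ρ x v + ε * fderiv ℝ ρ x w < 0 :=
    ((hcont.tendsto 0).mono_left nhdsWithin_le_nhds).eventually (gt_mem_nhds (by simpa using hv))
  obtain ⟨ε, h1, h2⟩ := (hev.and self_mem_nhdsWithin).exists
  have h2' : (0 : ℝ) < ε := h2
  have := hle (v + ε • w) (by simpa using h1)
  simp only [map_add, map_smul, smul_eq_mul] at this
  nlinarith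

end Outflow

/-! ### Enlarging the domain away from part of its boundary -/

section Enlargement

lemma natCast_le_smooth (n : ℕ) : (n : WithTop ℕ∞) ≤ ((⊤ : ℕ∞) : WithTop ℕ∞) :=
  WithTop.coe_le_coe.2 (le_top (a := (n : ℕ∞)))

theorem exists_contDiff_isGlobalFlow {E : Type} [NormedAddCommGroup E] [NormedSpace ℝ E]
    [CompleteSpace E] {F : E → E} {n : ℕ} (hn : n ≠ 0) (hF : ContDiff ℝ n F)
    (hc : HasCompactSupport F) : ∃ (φ : ℝ → E → E) (K : NNReal), LipschitzWith K F ∧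
      IsGlobalFlow F φ ∧ ContDiff ℝ n (Function.uncurry φ) := by
  have hn' : (n : WithTop ℕ∞) ≠ 0 := by exact_mod_cast hn
  obtain ⟨K, hK⟩ := hF.lipschitzWith_of_hasCompactSupport hc hn'
  obtain ⟨M, hM⟩ := hF.continuous.bounded_above_of_compact_support hc
  obtain ⟨φ, hφ⟩ := exists_isGlobalFlow hK hM
  exact ⟨φ, K, hK, hφ, hφ.contDiff hK hn hF⟩

/-- The time-`t` map of a global flow. -/
def IsGlobalFlow.homeomorph {E : Type} [NormedAddCommGroup E] [NormedSpace ℝ E]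
    {F : E → E} {φ : ℝ → E → E} {K : NNReal} (hφ : IsGlobalFlow F φ) (hL : LipschitzWith K F)
    (hc : Continuous (Function.uncurry φ)) (t : ℝ) : E ≃ₜ E where
  toFun := φ t
  invFun := φ (-t)
  left_inv := hφ.neg_cancel hL t
  right_inv := hφ.neg_cancel' hL t
  continuous_toFun := hc.comp (by fun_prop : Continuous fun x : E => (t, x))
  continuous_invFun := hc.comp (by fun_prop : Continuous fun x : E => (-t, x))

lemma contDiff_gradient {f : Plane → ℝ} {m n : WithTop ℕ∞} (hf : ContDiff ℝ n f) (hm : m + 1 ≤ n) :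
    ContDiff ℝ m (gradient f) :=
  (InnerProductSpace.toDual ℝ Plane).symm.contDiff.comp (hf.fderiv_right hm)

lemma fderiv_apply_gradient (f : Plane → ℝ) (x : Plane) :
    fderiv ℝ f x (gradient f x) = ‖gradient f x‖ ^ 2 := by
  rw [← inner_gradient_left, real_inner_self_eq_norm_sq]

/-- Pushing the boundary of a smooth domain outwards, away from a given closed part of it. -/
theorem IsGlobalDefiningFunction.exists_enlargement {Ω : Set Plane} {ρ : Plane → ℝ}
    (hρ : IsGlobalDefiningFunction ((⊤ : ℕ∞) : WithTop ℕ∞) Ω ρ) (hconn : IsConnected Ω)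
    (hbdd : Bornology.IsBounded Ω) {C : Set Plane} (hC : IsClosed C) (hCf : C ⊆ frontier Ω)
    {w : Plane} (hw : w ∈ frontier Ω) (hwC : w ∉ C) :
    ∃ (O : Set Plane) (r : Plane → ℝ), IsGlobalDefiningFunction (3 : ℕ) O r ∧ Ω ⊆ O ∧
      IsConnected O ∧ Bornology.IsBounded O ∧ frontier O ∩ closure Ω = C ∧
      (O \ closure Ω).Nonempty := by
  have htop : ((⊤ : ℕ∞) : WithTop ℕ∞) ≠ 0 := by simp
  obtain ⟨R, hR⟩ := hbdd.closure.subset_ball (0 : Plane)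
  obtain ⟨η, hη, hη1, hη2⟩ := (Metric.isOpen_ball.inter hC.isOpen_compl :
    IsOpen (Metric.ball (0 : Plane) R ∩ Cᶜ)).exists_contDiff_support_eq (n := ⊤)
  have hη0 : ∀ z, 0 ≤ η z := fun z => (hη2 ⟨z, rfl⟩).1
  have hηpos : ∀ z ∈ closure Ω, z ∉ C → 0 < η z := fun z hz hz' =>
    lt_of_le_of_ne (hη0 z) (Ne.symm (by
      have : z ∈ Function.support η := by rw [hη]; exact ⟨hR hz, hz'⟩
      exact this))
  have hηC : ∀ z ∈ C, η z = 0 := fun z hz => by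
    by_contra h
    have : z ∈ Function.support η := h
    rw [hη] at this
    exact this.2 hz
  -- The flow of this field fixes `C`, where `η` vanishes, and strictly increases `ρ` at the other
  -- boundary points; `O` is the image of Ω at time 1.
  let F : Plane → Plane := fun z => η z • gradient ρ z
  have hF : ContDiff ℝ (3 : ℕ) F := (hη1.of_le (natCast_le_smooth 3)).smul
    (contDiff_gradient hρ.contDiff (natCast_le_smooth 4))
  have hFc : HasCompactSupport F := by
    refine HasCompactSupport.intro (isCompact_closedBall (0 : Plane) R) fun z hz => ?_
    have : η z = 0 := by
      by_contra h
      have h' : z ∈ Function.support η := h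
      rw [hη] at h'
      exact hz (Metric.ball_subset_closedBall h'.1)
    simp only [F, this, zero_smul]
  obtain ⟨φ, K, hL, hφ, hφc⟩ := exists_contDiff_isGlobalFlow (n := 3) (by norm_num) hF hFc
  have hφt : ∀ t, ContDiff ℝ (3 : ℕ) (φ t) := fun t =>
    hφc.comp (by fun_prop : ContDiff ℝ (3 : ℕ) fun x : Plane => (t, x))
  let e := hφ.homeomorph hL hφc.continuous (-1)
  -- monotonicity of `ρ` along the flow
  have hder : ∀ x t, HasDerivAt (fun s => ρ (φ s x))
      (η (φ t x) * ‖gradient ρ (φ t x)‖ ^ 2) t := fun x t => by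
    have := (hρ.differentiable htop (φ t x)).hasFDerivAt.comp_hasDerivAt t (hφ.deriv x t)
    simp only [F, map_smul, fderiv_apply_gradient, smul_eq_mul] at this
    exact this
  have hmono : ∀ x, Monotone fun s => ρ (φ s x) := fun x =>
    monotone_of_deriv_nonneg (fun t => (hder x t).differentiableAt) fun t => by
      rw [(hder x t).deriv]
      exact mul_nonneg (hη0 _) (sq_nonneg _)
  have hpos0 : ∀ x ∈ frontier Ω, x ∉ C → 0 < η (φ 0 x) * ‖gradient ρ (φ 0 x)‖ ^ 2 := by
    intro x hx hxC
    rw [hφ.zero]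
    have := norm_pos_iff.2 (gradient_ne_zero_iff.2 (hρ.fderiv_ne x hx))
    exact mul_pos (hηpos x (frontier_subset_closure hx) hxC) (by positivity)
  have hfix : ∀ x ∈ C, ∀ t, φ t x = x := fun x hx t => hφ.eq_self hL (by
    simp only [F, hηC x hx, zero_smul]) t
  let r : Plane → ℝ := fun x => ρ (φ (-1) x)
  let O : Set Plane := φ (-1) ⁻¹' Ω
  have hrρ : ∀ x, r x ≤ ρ x := fun x => by
    have := hmono x (show (-1 : ℝ) ≤ 0 by norm_num)
    simpa only [hφ.zero] using this
  have hOfr : ∀ x, x ∈ frontier O ↔ r x = 0 := fun x => by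
    have : frontier O = φ (-1) ⁻¹' frontier Ω := (e.preimage_frontier Ω).symm
    rw [this, mem_preimage, hρ.mem_frontier_iff]
  have hO : IsGlobalDefiningFunction (3 : ℕ) O r := by
    refine ⟨(hρ.contDiff.of_le (natCast_le_smooth 3)).comp (hφt (-1)),
      fun z => hρ.mem_iff _, hOfr, fun z hz hcon => ?_⟩
    have hz' : φ (-1) z ∈ frontier Ω := (hρ.mem_frontier_iff _).2 ((hOfr z).1 hz)
    refine hρ.fderiv_ne _ hz' ?_
    have hr : HasFDerivAt r (0 : Plane →L[ℝ] ℝ) z := by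
      rw [← hcon]
      exact (((hρ.differentiable htop).comp ((hφt (-1)).differentiable (by norm_num))) z).hasFDerivAt
    have h1 : HasFDerivAt ρ ((0 : Plane →L[ℝ] ℝ).comp (fderiv ℝ (φ 1) (φ (-1) z))) (φ (-1) z) := by
      have heq : ρ = r ∘ φ 1 := by
        ext x
        simp only [r, Function.comp, hφ.neg_cancel hL 1 x]
      rw [heq]
      refine HasFDerivAt.comp _ ?_ ((hφt 1).differentiable (by norm_num) _).hasFDerivAt
      rwa [hφ.neg_cancel' hL 1 z]
    rw [h1.fderiv, ContinuousLinearMap.zero_comp]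
  have hOimg : O = φ 1 '' Ω := by
    ext x
    constructor
    · exact fun hx => ⟨φ (-1) x, hx, hφ.neg_cancel' hL 1 x⟩
    · rintro ⟨y, hy, rfl⟩
      change φ (-1) (φ 1 y) ∈ Ω
      rwa [hφ.neg_cancel hL 1 y]
  refine ⟨O, r, hO, fun x hx => (hO.mem_iff x).2 ((hrρ x).trans_lt ((hρ.mem_iff x).1 hx)), ?_, ?_,
    ?_, ?_⟩
  · rw [hOimg]
    exact hconn.image _ (hφt 1).continuous.continuousOn
  · rw [hOimg]
    exact ((Metric.isCompact_of_isClosed_isBounded isClosed_closure hbdd.closure).image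
      (hφt 1).continuous).isBounded.subset (image_mono subset_closure)
  -- On the common part, r ≤ ρ ≤ 0 = r forces ρ = 0. Off `C`, going back along the flow would make
  -- `ρ` strictly negative, contradicting r = 0.
  · ext x
    constructor
    · rintro ⟨hx1, hx2⟩
      by_contra hxC
      have h1 : r x = 0 := (hOfr x).1 hx1
      have h2 : ρ x = 0 := le_antisymm (hρ.mem_closure_iff.1 hx2) (h1 ▸ hrρ x)
      have h3 := hpos0 x ((hρ.mem_frontier_iff x).2 h2) hxC
      have h4 := (hder x 0).tendsto_slope_zero_left.eventually (lt_mem_nhds h3)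
      have h5 : ∀ᶠ t : ℝ in 𝓝[<] 0, -1 < t :=
        mem_nhdsWithin_of_mem_nhds (lt_mem_nhds (by norm_num))
      obtain ⟨t, ⟨h6, h7⟩, h8⟩ := ((h4.and h5).and self_mem_nhdsWithin).exists
      have h8' : t < 0 := h8
      simp only [zero_add, hφ.zero, h2, sub_zero, smul_eq_mul] at h6
      have h9 : ρ (φ t x) < 0 := by
        by_contra hcon
        push Not at hcon
        have : t⁻¹ * ρ (φ t x) ≤ 0 :=
          mul_nonpos_of_nonpos_of_nonneg (inv_nonpos.2 h8'.le) hcon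
        linarith
      have h10 : ρ (φ (-1) x) ≤ ρ (φ t x) := hmono x h7.le
      have h11 : ρ (φ (-1) x) = 0 := h1
      linarith
    · intro hx
      have hρx := (hρ.mem_frontier_iff x).1 (hCf hx)
      refine ⟨(hOfr x).2 ?_, frontier_subset_closure (hCf hx)⟩
      simp only [r, hfix x hx, hρx]
  -- The boundary point `w` is carried to a point of the closure of `O` lying outside the closure of
  -- Ω; a nearby point of `O` does too.
  · have h0 := (hρ.mem_frontier_iff w).1 hw
    have h4 := (hder w 0).tendsto_slope_zero_right.eventually (lt_mem_nhds (hpos0 w hw hwC))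
    have h5 : ∀ᶠ t : ℝ in 𝓝[>] 0, t < 1 :=
      mem_nhdsWithin_of_mem_nhds (gt_mem_nhds (by norm_num))
    obtain ⟨t, ⟨h6, h7⟩, h8⟩ := ((h4.and h5).and self_mem_nhdsWithin).exists
    have h8' : 0 < t := h8
    simp only [zero_add, hφ.zero, h0, sub_zero, smul_eq_mul] at h6
    have h9 : 0 < ρ (φ t w) := pos_of_mul_pos_right h6 (inv_nonneg.2 h8'.le)
    have h10 : ρ (φ t w) ≤ ρ (φ 1 w) := hmono w h7.le
    have hp : φ 1 w ∈ (closure Ω)ᶜ := fun h => by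
      have := hρ.mem_closure_iff.1 h
      linarith
    have hp' : φ 1 w ∈ closure O := frontier_subset_closure ((hOfr _).2 (by
      simp only [r, hφ.neg_cancel hL 1 w, h0]))
    obtain ⟨q, hq1, hq2⟩ := _root_.mem_closure_iff.1 hp' _ isClosed_closure.isOpen_compl hp
    exact ⟨q, hq2, hq1⟩

end Enlargement

/-! ### Moving finite sets by compactly supported diffeomorphisms -/

section MovingPoints

/-- A punctured disc is connected, being the image of (0,r) × S¹. It therefore lies on one side of
any separation of the punctured set, and filling in `q` on that side would separate `U`. -/
lemma IsPreconnected.diff_singleton {U : Set Plane} (hU : IsOpen U) (h : IsPreconnected U)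
    (q : Plane) : IsPreconnected (U \ {q}) := by
  by_cases hq : q ∈ U
  swap
  · rwa [sdiff_singleton_eq_self hq]
  obtain ⟨r, hr, hball⟩ := Metric.isOpen_iff.1 hU q hq
  have hrank : 1 < Module.rank ℝ Plane := by
    rw [← Module.finrank_eq_rank]
    simp only [finrank_euclideanSpace, Fintype.card_fin]
    norm_num
  -- the punctured ball is connected
  have hP : IsPreconnected (Metric.ball q r \ {q}) := by
    have himg : Metric.ball q r \ {q} =
        (fun p : ℝ × Plane => q + p.1 • p.2) '' (Ioo 0 r ×ˢ Metric.sphere (0 : Plane) 1) := by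
      ext x
      constructor
      · rintro ⟨hx, hxq⟩
        have hpos : 0 < ‖x - q‖ := norm_pos_iff.2 (sub_ne_zero.2 hxq)
        refine ⟨(‖x - q‖, ‖x - q‖⁻¹ • (x - q)), ⟨⟨hpos, by simpa [dist_eq_norm] using hx⟩, ?_⟩, ?_⟩
        · simp [norm_smul, hpos.ne']
        · simp [smul_inv_smul₀ hpos.ne']
      · rintro ⟨⟨t, u⟩, ⟨ht, hu⟩, rfl⟩
        have hu' : ‖u‖ = 1 := by simpa using hu
        refine ⟨by simpa [dist_eq_norm, norm_smul, hu', abs_of_pos ht.1] using ht.2, fun h => ?_⟩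
        have h0 : t • u = 0 := by simpa using h
        rcases smul_eq_zero.1 h0 with h1 | h1
        · exact ht.1.ne' h1
        · rw [h1, norm_zero] at hu'; exact zero_ne_one hu'
    rw [himg]
    exact (isPreconnected_Ioo.prod (isPreconnected_sphere hrank 0 1)).image _
      (by fun_prop : Continuous fun p : ℝ × Plane => q + p.1 • p.2).continuousOn
  rw [isPreconnected_iff_subset_of_disjoint]
  have key : ∀ u v : Set Plane, IsOpen u → IsOpen v → U \ {q} ⊆ u ∪ v → (U \ {q}) ∩ (u ∩ v) = ∅ →
      Metric.ball q r \ {q} ⊆ u → U \ {q} ⊆ u ∨ U \ {q} ⊆ v := by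
    intro u v hu hv hsub hdisj hbu
    have h1 := isPreconnected_iff_subset_of_disjoint.1 h (u ∪ Metric.ball q r) (v \ {q})
      (hu.union Metric.isOpen_ball) (hv.sdiff isClosed_singleton) (by
        intro x hx
        by_cases hxq : x = q
        · rw [hxq]; exact .inl (.inr (Metric.mem_ball_self hr))
        · rcases hsub ⟨hx, hxq⟩ with h | h
          · exact .inl (.inl h)
          · exact .inr ⟨h, hxq⟩) (by
        rw [eq_empty_iff_forall_notMem] at hdisj ⊢
        rintro x ⟨hxU, hx1, hx2, hxq⟩
        rcases hx1 with h | h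
        · exact hdisj x ⟨⟨hxU, hxq⟩, h, hx2⟩
        · exact hdisj x ⟨⟨hxU, hxq⟩, hbu ⟨h, hxq⟩, hx2⟩)
    rcases h1 with h1 | h1
    · left
      rintro x ⟨hxU, hxq⟩
      rcases h1 hxU with h | h
      · exact h
      · exact hbu ⟨h, hxq⟩
    · exact .inr fun x hx => (h1 hx.1).1
  intro u v hu hv hsub hdisj
  have hbsub : Metric.ball q r \ {q} ⊆ U \ {q} := sdiff_subset_sdiff_left hball
  rcases isPreconnected_iff_subset_of_disjoint.1 hP u v hu hv (hbsub.trans hsub)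
    (subset_empty_iff.1 (hdisj ▸ inter_subset_inter_left _ hbsub)) with h1 | h1
  · exact key u v hu hv hsub hdisj h1
  · exact (key v u hv hu (by rwa [union_comm]) (by rwa [inter_comm v u]) h1).symm

lemma IsPreconnected.diff_finite {U : Set Plane} (hU : IsOpen U) (h : IsPreconnected U)
    {Q : Set Plane} (hQ : Q.Finite) : IsPreconnected (U \ Q) := by
  induction Q, hQ using Set.Finite.induction_on with
  | empty => simpa using h
  | @insert a s _ hs ih =>
    have : U \ insert a s = (U \ s) \ {a} := by
      rw [sdiff_sdiff, union_singleton]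
    rw [this]
    exact ih.diff_singleton (hU.sdiff hs.isClosed) a

/-- A `C²` diffeomorphism of the plane which is the identity outside a compact part of `U`. -/
structure IsSupportedDiffeo (U : Set Plane) (h : Plane ≃ Plane) : Prop where
  contDiff : ContDiff ℝ 2 h
  contDiff_symm : ContDiff ℝ 2 h.symm
  support : ∃ K, IsCompact K ∧ K ⊆ U ∧ ∀ x ∉ K, h x = x

namespace IsSupportedDiffeo

variable {U V : Set Plane} {h g : Plane ≃ Plane}

lemma refl : IsSupportedDiffeo U (Equiv.refl Plane) :=
  ⟨contDiff_id, contDiff_id, ∅, isCompact_empty, empty_subset _, fun _ _ => rfl⟩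

lemma symm (hh : IsSupportedDiffeo U h) : IsSupportedDiffeo U h.symm := by
  obtain ⟨K, h1, h2, h3⟩ := hh.support
  exact ⟨hh.contDiff_symm, hh.contDiff, K, h1, h2, fun x hx => by
    rw [Equiv.symm_apply_eq, h3 x hx]⟩

lemma trans (hh : IsSupportedDiffeo U h) (hg : IsSupportedDiffeo U g) :
    IsSupportedDiffeo U (h.trans g) := by
  obtain ⟨K, h1, h2, h3⟩ := hh.support
  obtain ⟨L, g1, g2, g3⟩ := hg.support
  refine ⟨hg.contDiff.comp hh.contDiff, hh.contDiff_symm.comp hg.contDiff_symm, K ∪ L, h1.union g1,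
    union_subset h2 g2, fun x hx => ?_⟩
  rw [mem_union, not_or] at hx
  rw [Equiv.trans_apply, h3 x hx.1, g3 x hx.2]

lemma mono (hh : IsSupportedDiffeo U h) (hUV : U ⊆ V) : IsSupportedDiffeo V h := by
  obtain ⟨K, h1, h2, h3⟩ := hh.support
  exact ⟨hh.contDiff, hh.contDiff_symm, K, h1, h2.trans hUV, h3⟩

lemma eq_self (hh : IsSupportedDiffeo U h) {x : Plane} (hx : x ∉ U) : h x = x := by
  obtain ⟨K, h1, h2, h3⟩ := hh.support
  exact h3 x fun h => hx (h2 h)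

lemma mem_of_mem (hh : IsSupportedDiffeo U h) {x : Plane} (hx : x ∈ U) : h x ∈ U := by
  by_contra hcon
  have := h.injective (hh.eq_self hcon)
  rw [this] at hcon
  exact hcon hx

end IsSupportedDiffeo

/-- Time-one map of a cut-off constant field q - p: the cutoff is 1 on a ball containing the
segment, so `p` travels straight to `q`. -/
lemma exists_isSupportedDiffeo_of_closedBall {U : Set Plane} {c : Plane} {r : ℝ}
    (hU : Metric.closedBall c r ⊆ U) {p q : Plane} (hp : p ∈ Metric.ball c r)
    (hq : q ∈ Metric.ball c r) : ∃ h, IsSupportedDiffeo U h ∧ h p = q := by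
  obtain ⟨s, hs1, hs2⟩ := exists_between (max_lt (Metric.mem_ball.1 hp) (Metric.mem_ball.1 hq))
  rw [max_lt_iff] at hs1
  have hs0 : 0 < s := dist_nonneg.trans_lt hs1.1
  let χ : ContDiffBump c := ⟨s, r, hs0, hs2⟩
  let F : Plane → Plane := fun x => χ x • (q - p)
  have hF : ContDiff ℝ (2 : ℕ) F := χ.contDiff.smul contDiff_const
  have hFc : HasCompactSupport F := χ.hasCompactSupport.smul_right
  obtain ⟨φ, K, hL, hφ, hφc⟩ := exists_contDiff_isGlobalFlow (by norm_num) hF hFc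
  have hφt : ∀ t, ContDiff ℝ (2 : ℕ) (φ t) := fun t =>
    hφc.comp (by fun_prop : ContDiff ℝ (2 : ℕ) fun x : Plane => (t, x))
  let h : Plane ≃ Plane := ⟨φ 1, φ (-1), hφ.neg_cancel hL 1, hφ.neg_cancel' hL 1⟩
  refine ⟨h, ⟨hφt 1, hφt (-1), Metric.closedBall c r, isCompact_closedBall c r, hU, fun x hx => ?_⟩,
    ?_⟩
  · refine hφ.eq_self hL ?_ 1
    have : χ x = 0 := χ.zero_of_le_dist (le_of_lt (by simpa using hx))
    simp only [F, this, zero_smul]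
  · have hseg : ∀ t ∈ Icc (0 : ℝ) 1, p + t • (q - p) ∈ Metric.closedBall c s := fun t ht =>
      (convex_closedBall c s).add_smul_sub_mem (Metric.mem_closedBall.2 hs1.1.le)
        (Metric.mem_closedBall.2 hs1.2.le) ht
    have hline : ∀ t : ℝ, HasDerivAt (fun t : ℝ => p + t • (q - p)) (q - p) t := fun t => by
      simpa using ((hasDerivAt_id t).smul_const (q - p)).const_add p
    have := ODE_solution_unique (v := fun _ : ℝ => F) (K := K) (f := fun t => φ t p)
      (g := fun t => p + t • (q - p)) (a := 0) (b := 1) (fun _ => hL)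
      (hφ.continuous_time p).continuousOn (fun t _ => (hφ.deriv p t).hasDerivWithinAt)
      (by fun_prop) (fun t ht => by
        have h1 : F (p + t • (q - p)) = q - p := by
          simp only [F]
          rw [χ.one_of_mem_closedBall (hseg t (Ico_subset_Icc_self ht)), one_smul]
        rw [h1]
        exact (hline t).hasDerivWithinAt) (by simp [hφ.zero])
    have h1 := this (right_mem_Icc.2 zero_le_one)
    simp only [one_smul, add_sub_cancel] at h1
    exact h1

/-- Supported diffeomorphisms act transitively on a connected open set. -/
lemma exists_isSupportedDiffeo {U : Set Plane} (hU : IsOpen U) (hc : IsPreconnected U) {p q : Plane}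
    (hp : p ∈ U) (hq : q ∈ U) : ∃ h, IsSupportedDiffeo U h ∧ h p = q := by
  refine hc.induction₂ (fun x y => ∃ h, IsSupportedDiffeo U h ∧ h x = y) ?_ ?_ ?_ hp hq
  · intro x hx
    obtain ⟨r, hr, hball⟩ := Metric.nhds_basis_closedBall.mem_iff.1 (hU.mem_nhds hx)
    filter_upwards [mem_nhdsWithin_of_mem_nhds (Metric.ball_mem_nhds x hr)] with y hy
    exact exists_isSupportedDiffeo_of_closedBall hball (Metric.mem_ball_self hr) hy
  · rintro x y z _ _ _ ⟨h, h1, h2⟩ ⟨g, g1, g2⟩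
    exact ⟨h.trans g, h1.trans g1, by rw [Equiv.trans_apply, h2, g2]⟩
  · rintro x y _ _ ⟨h, h1, h2⟩
    exact ⟨h.symm, h1.symm, by rw [Equiv.symm_apply_eq, h2]⟩

/-- A finite subset of a connected open set can be moved into any given open part of it. -/
theorem exists_isSupportedDiffeo_image_subset {U : Set Plane} (hU : IsOpen U)
    (hc : IsPreconnected U) {B : Set Plane} (hB : IsOpen B) (hBne : B.Nonempty) (hBU : B ⊆ U)
    {Z : Set Plane} (hZ : Z.Finite) (hZU : Z ⊆ U) :
    ∃ h, IsSupportedDiffeo U h ∧ ∀ z ∈ Z, h z ∈ B := by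
  induction Z, hZ using Set.Finite.induction_on with
  | empty => exact ⟨_, .refl, fun _ h => h.elim⟩
  | @insert a s ha hs ih =>
    obtain ⟨h, h1, h2⟩ := ih ((subset_insert a s).trans hZU)
    have hQ : (h '' s).Finite := hs.image h
    have hinf : B.Infinite := by
      obtain ⟨b, hb⟩ := hBne
      exact infinite_of_mem_nhds b (hB.mem_nhds hb)
    obtain ⟨q, hqB, hqQ⟩ := (hinf.sdiff hQ).nonempty
    have haQ : h a ∉ h '' s := fun ⟨b, hb, hba⟩ => ha (h.injective hba ▸ hb)
    -- The points already placed are removed from `U`, so moving the new one leaves them fixed; the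
    -- remaining set is still connected.
    obtain ⟨g, g1, g2⟩ := exists_isSupportedDiffeo (hU.sdiff hQ.isClosed)
      (hc.diff_finite hU hQ) ⟨h1.mem_of_mem (hZU (mem_insert a s)), haQ⟩ ⟨hBU hqB, hqQ⟩
    refine ⟨h.trans g, h1.trans (g1.mono sdiff_subset), fun z hz => ?_⟩
    rw [Equiv.trans_apply]
    rcases hz with rfl | hz
    · rwa [g2]
    · rw [g1.eq_self fun hcon => hcon.2 ⟨z, hz, rfl⟩]
      exact h2 z hz

end MovingPoints

/-! ### Confining critical points to a small set -/

section Morse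

open scoped Manifold in
/-- A smooth function equal to `0` near a closed set and to `1` near a disjoint one. -/
lemma exists_contDiff_zero_one_nhds {s t : Set Plane} (hs : IsClosed s) (ht : IsClosed t)
    (hd : Disjoint s t) : ∃ f : Plane → ℝ, ContDiff ℝ ((⊤ : ℕ∞) : WithTop ℕ∞) f ∧
      (∀ x ∈ s, ∀ᶠ y in 𝓝 x, f y = 0) ∧ (∀ x ∈ t, ∀ᶠ y in 𝓝 x, f y = 1) ∧
      ∀ x, f x ∈ Icc (0 : ℝ) 1 := by
  obtain ⟨f, h1, h2, h3⟩ := exists_contMDiffMap_zero_one_nhds_of_isClosed (n := ((⊤ : ℕ∞)))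
    𝓘(ℝ, Plane) hs ht hd
  exact ⟨f, f.contMDiff.contDiff, eventually_nhdsSet_iff_forall.1 h1,
    eventually_nhdsSet_iff_forall.1 h2, h3⟩

/-- Sard: a small linear perturbation makes all critical points isolated. -/
lemma exists_small_regular {f : Plane → ℝ} {O : Set Plane} (hO : IsOpen O)
    (hf : ContDiffOn ℝ 2 f O) {U : Set Plane} (hU : U ∈ 𝓝 (0 : Plane)) :
    ∃ a ∈ U, ∀ x ∈ O, gradient f x + a = 0 → ∀ᶠ y in 𝓝[≠] x, gradient f y + a ≠ 0 := by
  have hg : ContDiffOn ℝ 1 (gradient f) O :=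
    (InnerProductSpace.toDual ℝ Plane).symm.contDiff.comp_contDiffOn
      (hf.fderiv_of_isOpen hO (by norm_num))
  have hd : ∀ x ∈ O, HasFDerivAt (gradient f) (fderiv ℝ (gradient f) x) x := fun x hx =>
    ((hg.contDiffAt (hO.mem_nhds hx)).differentiableAt (by norm_num)).hasFDerivAt
  let S := {x ∈ O | (fderiv ℝ (gradient f) x).det = 0}
  -- The C¹ gradient map of the plane has a null set of critical values. A regular value `b` close
  -- to 0 gives `a = -b`.
  have hnull : MeasureTheory.volume (gradient f '' S) = 0 :=
    MeasureTheory.addHaar_image_eq_zero_of_det_fderivWithin_eq_zero MeasureTheory.volume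
      (fun x hx => (hd x hx.1).hasFDerivWithinAt) fun x hx => hx.2
  have hdense : Dense (gradient f '' S)ᶜ :=
    MeasureTheory.Measure.dense_of_ae (p := fun x => x ∉ gradient f '' S)
      (MeasureTheory.measure_eq_zero_iff_ae_notMem.1 hnull)
  have hU' : (fun x : Plane => -x) ⁻¹' U ∈ 𝓝 (0 : Plane) :=
    (continuous_neg.tendsto' (0 : Plane) 0 neg_zero) hU
  obtain ⟨b, hb1, hb2⟩ := hdense.inter_nhds_nonempty hU'
  refine ⟨-b, hb2, fun x hx h0 => ?_⟩
  have hxb : gradient f x = b := by rwa [← sub_eq_add_neg, sub_eq_zero] at h0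
  have hdet : (fderiv ℝ (gradient f) x).det ≠ 0 := fun h => hb1 ⟨x, ⟨hx, h⟩, hxb⟩
  let e := (fderiv ℝ (gradient f) x).toContinuousLinearEquivOfDetNeZero hdet
  have hanti : ∃ C, AntilipschitzWith C (fderiv ℝ (gradient f) x) := ⟨_, e.antilipschitz⟩
  filter_upwards [(hd x hx).eventually_ne hanti (c := b)] with y hy
  rwa [← sub_eq_add_neg, Ne, sub_eq_zero]

/-- A function given near the boundary of `O`, without critical points there, can be changed
inside `O` so that all its critical points lie in a prescribed open set. -/
theorem exists_contDiffOn_critical_subset {O D B : Set Plane} (hO : IsOpen O)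
    (hconn : IsPreconnected O) (hbdd : Bornology.IsBounded O) (hD : IsOpen D)
    (hfr : frontier O ⊆ D) {τ : Plane → ℝ} (hτ : ContDiffOn ℝ 2 τ D)
    (hτ' : ∀ x ∈ D, fderiv ℝ τ x ≠ 0) {c : ℝ} (hc : ∀ x ∈ D ∩ O, c < τ x) (hB : IsOpen B)
    (hBne : B.Nonempty) (hBO : B ⊆ O) :
    ∃ f : Plane → ℝ, ContDiffOn ℝ 2 f (O ∪ D) ∧ (∀ x ∈ D \ O, f x = τ x) ∧
      (∀ x ∈ O, c < f x) ∧ ∀ x ∈ O ∪ D, fderiv ℝ f x = 0 → x ∈ B := by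
  have hW : IsOpen (O ∪ D) := hO.union hD
  have hcl : ∀ x ∈ closure O, x ∉ D → x ∈ O := fun x hx hxD => by
    rw [closure_eq_self_union_frontier] at hx
    exact hx.resolve_right fun h => hxD (hfr h)
  -- interpolation between `τ` and a constant
  obtain ⟨κ, κ1, κ2, κ3, κ4⟩ := exists_contDiff_zero_one_nhds (s := closure O \ D) (t := Oᶜ)
    (isClosed_closure.sdiff hD) hO.isClosed_compl
    (disjoint_left.2 fun x hx hx' => hx' (hcl x hx.1 hx.2))
  have κ1' : ContDiff ℝ 2 κ := κ1.of_le (natCast_le_smooth 2)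
  -- `κ` is 1 near the complement of `O` and 0 where `τ` is not available. In `O` this is a convex
  -- combination of values exceeding `c`.
  let f₀ : Plane → ℝ := fun x => κ x * τ x + (1 - κ x) * (c + 1)
  have hf₀ : ContDiffOn ℝ 2 f₀ (O ∪ D) := by
    intro x hx
    by_cases hxD : x ∈ D
    · have h1 : ContDiffAt ℝ 2 τ x := hτ.contDiffAt (hD.mem_nhds hxD)
      have h2 : ContDiffAt ℝ 2 κ x := κ1'.contDiffAt
      have : ContDiffAt ℝ 2 f₀ x := (h2.mul h1).add ((contDiffAt_const.sub h2).mul contDiffAt_const)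
      exact this.contDiffWithinAt
    · have hxO := hx.resolve_right hxD
      have : ContDiffAt ℝ 2 f₀ x := by
        refine (contDiffAt_const (c := c + 1)).congr_of_eventuallyEq ?_
        filter_upwards [κ2 x ⟨subset_closure hxO, hxD⟩] with y hy
        simp only [f₀, hy]; ring
      exact this.contDiffWithinAt
  have hf₀d : ∀ x ∈ O ∪ D, HasFDerivAt f₀ (fderiv ℝ f₀ x) x := fun x hx =>
    ((hf₀.contDiffAt (hW.mem_nhds hx)).differentiableAt (by norm_num)).hasFDerivAt
  have hf₀c : ∀ x ∈ O ∪ D, ContinuousAt (fderiv ℝ f₀) x := fun x hx =>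
    (hf₀.continuousOn_fderiv_of_isOpen hW (by norm_num)).continuousAt (hW.mem_nhds hx)
  have hf₀pos : ∀ x ∈ O, c < f₀ x := by
    intro x hx
    by_cases hxD : x ∈ D
    · have h1 := hc x ⟨hxD, hx⟩
      obtain ⟨h2, h3⟩ := κ4 x
      simp only [f₀]
      rcases h2.eq_or_lt with h | h
      · rw [← h]; linarith
      · nlinarith
    · have := (κ2 x ⟨subset_closure hx, hxD⟩).self_of_nhds
      simp only [f₀, this]; linarith
  -- outside of the compact set `S`, the function is unchanged
  set S : Set Plane := {x | ∀ᶠ y in 𝓝 x, κ y = 1}ᶜ with hSdef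
  have hSc : IsClosed S := (isOpen_setOfPred_eventually_nhds (p := fun y => κ y = 1)).isClosed_compl
  have hSO : S ⊆ O := fun x hx => by
    by_contra h
    exact hx (κ3 x h)
  have hSnc : ∀ x ∈ O ∪ D, x ∉ S → fderiv ℝ f₀ x ≠ 0 := by
    intro x hx hxS
    have hev : ∀ᶠ y in 𝓝 x, κ y = 1 := not_not.1 hxS
    have hxD : x ∈ D := by
      by_contra hxD
      have h0 := (κ2 x ⟨subset_closure (hx.resolve_right hxD), hxD⟩).self_of_nhds
      have h1 := hev.self_of_nhds
      rw [h0] at h1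
      exact zero_ne_one h1
    have : f₀ =ᶠ[𝓝 x] τ := by
      filter_upwards [hev] with y hy
      simp only [f₀, hy]; ring
    rw [this.fderiv_eq]
    exact hτ' x hxD
  -- the cutoff of the perturbation
  obtain ⟨χ, χ1, χ2, χ3, χ4⟩ := exists_contDiff_zero_one_nhds (s := Oᶜ) (t := S) hO.isClosed_compl
    hSc (disjoint_left.2 fun x hx hx' => hx (hSO hx'))
  have χ1' : ContDiff ℝ 2 χ := χ1.of_le (natCast_le_smooth 2)
  have χd : Differentiable ℝ χ := χ1'.differentiable (by norm_num)
  set S' : Set Plane := {x | ∀ᶠ y in 𝓝 x, χ y = 0}ᶜ with hS'def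
  set N : Set Plane := {x | ∀ᶠ y in 𝓝 x, χ y = 1} with hNdef
  have hNo : IsOpen N := isOpen_setOfPred_eventually_nhds (p := fun y => χ y = 1)
  have hS'O : S' ⊆ O := fun x hx => by
    by_contra h
    exact hx (χ2 x h)
  have hS'K : IsCompact S' := Metric.isCompact_of_isClosed_isBounded
    (isOpen_setOfPred_eventually_nhds (p := fun y => χ y = 0)).isClosed_compl (hbdd.subset hS'O)
  have hNS' : N ⊆ S' := fun x hx hx' => by
    have h0 := Filter.Eventually.self_of_nhds hx'
    have h1 := Filter.Eventually.self_of_nhds hx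
    rw [h0] at h1
    exact zero_ne_one h1
  have hSN : S ⊆ N := fun x hx => χ3 x hx
  let G : Plane × Plane → (Plane →L[ℝ] ℝ) := fun z =>
    fderiv ℝ f₀ z.2 + (χ z.2 • innerSL ℝ z.1 + (inner ℝ z.1 z.2 : ℝ) • fderiv ℝ χ z.2)
  -- The transition zone of `χ` is compact and free of critical points of `f₀`, so a small
  -- perturbation creates none there.
  have hsmall1 : ∀ᶠ a in 𝓝 (0 : Plane), ∀ x ∈ S' \ N, G (a, x) ≠ 0 := by
    refine (hS'K.diff hNo).eventually_forall_of_forall_eventually fun x hx => ?_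
    have hxW : x ∈ O ∪ D := .inl (hS'O hx.1)
    have hcont : ContinuousAt G (0, x) := by
      have h1 : ContinuousAt (fun z : Plane × Plane => fderiv ℝ f₀ z.2) (0, x) :=
        ContinuousAt.comp (f := Prod.snd) (hf₀c x hxW) continuousAt_snd
      have h2 : Continuous (fderiv ℝ χ) := χ1'.continuous_fderiv (by norm_num)
      have h3 : Continuous χ := χ1'.continuous
      have h4 : Continuous fun z : Plane × Plane =>
          χ z.2 • innerSL ℝ z.1 + (inner ℝ z.1 z.2 : ℝ) • fderiv ℝ χ z.2 := by fun_prop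
      exact h1.add h4.continuousAt
    have hne : G (0, x) ≠ 0 := by
      simp only [G, map_zero, smul_zero, inner_zero_left, zero_smul, add_zero]
      exact hSnc x hxW fun h => hx.2 (hSN h)
    exact hcont.eventually_ne hne
  have hsmall2 : ∀ᶠ a in 𝓝 (0 : Plane), ∀ x ∈ S', c < f₀ x + χ x * inner ℝ a x := by
    refine hS'K.eventually_forall_of_forall_eventually fun x hx => ?_
    have hcont : ContinuousAt (fun z : Plane × Plane => f₀ z.2 + χ z.2 * inner ℝ z.1 z.2) (0, x) := by
      have h1 : ContinuousAt (fun z : Plane × Plane => f₀ z.2) (0, x) :=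
        ContinuousAt.comp (g := f₀) (f := Prod.snd) (hf₀d x (.inl (hS'O hx))).continuousAt continuousAt_snd
      have h3 : Continuous χ := χ1'.continuous
      have h4 : Continuous fun z : Plane × Plane => χ z.2 * (inner ℝ z.1 z.2 : ℝ) := by fun_prop
      exact h1.add h4.continuousAt
    refine hcont.eventually (lt_mem_nhds ?_)
    simpa using hf₀pos x (hS'O hx)
  obtain ⟨a, ⟨ha1, ha2⟩, ha3⟩ := exists_small_regular hO (hf₀.mono subset_union_left)
    (hsmall1.and hsmall2)
  let f₁ : Plane → ℝ := fun x => f₀ x + χ x * inner ℝ a x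
  have hinner : ∀ x : Plane, HasFDerivAt (fun x : Plane => (inner ℝ a x : ℝ)) (innerSL ℝ a) x :=
    fun x => (innerSL ℝ a).hasFDerivAt
  have hf₁ : ContDiffOn ℝ 2 f₁ (O ∪ D) :=
    hf₀.add (χ1'.mul (innerSL ℝ a).contDiff).contDiffOn
  have hf₁d : ∀ x ∈ O ∪ D, HasFDerivAt f₁ (G (a, x)) x := fun x hx =>
    (hf₀d x hx).add ((χd x).hasFDerivAt.mul (hinner x))
  have hf₁c : ∀ x ∈ O ∪ D, ContinuousAt (fderiv ℝ f₁) x := fun x hx =>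
    (hf₁.continuousOn_fderiv_of_isOpen hW (by norm_num)).continuousAt (hW.mem_nhds hx)
  have hN : ∀ x ∈ N, fderiv ℝ f₁ x = fderiv ℝ f₀ x + innerSL ℝ a := by
    intro x hx
    have hd : HasFDerivAt f₁ (fderiv ℝ f₀ x + innerSL ℝ a) x := by
      refine ((hf₀d x (.inl (hS'O (hNS' hx)))).add (hinner x)).congr_of_eventuallyEq ?_
      have hx' : ∀ᶠ y in 𝓝 x, χ y = 1 := hx
      filter_upwards [hx'] with y hy
      simp only [f₁, hy, one_mul, Pi.add_apply]
    exact hd.fderiv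
  have hcritN : ∀ x ∈ O ∪ D, fderiv ℝ f₁ x = 0 → x ∈ N := by
    intro x hx hx0
    by_contra hxN
    by_cases hxS' : x ∈ S'
    · exact ha1 x ⟨hxS', hxN⟩ ((hf₁d x hx).fderiv ▸ hx0)
    · have hev : ∀ᶠ y in 𝓝 x, χ y = 0 := not_not.1 hxS'
      have : f₁ =ᶠ[𝓝 x] f₀ := by
        filter_upwards [hev] with y hy
        simp only [f₁, hy, zero_mul, add_zero]
      rw [this.fderiv_eq] at hx0
      exact hSnc x hx (fun h => hxN (hSN h)) hx0
  let Z : Set Plane := {x ∈ S' | fderiv ℝ f₁ x = 0}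
  have hgradN : ∀ x ∈ N, (fderiv ℝ f₁ x = 0 ↔ gradient f₀ x + a = 0) := by
    intro x hx
    rw [hN x hx, ← toDual_gradient, ← (InnerProductSpace.toDual ℝ Plane).map_eq_zero_iff, map_add]
    rfl
  -- An accumulation point would itself be critical, hence lie in `N`, where critical points are
  -- isolated by the choice of `a`.
  have hZfin : Z.Finite := by
    by_contra hinf
    obtain ⟨x, hxS', hacc⟩ := Set.Infinite.exists_accPt_of_subset_isCompact hinf hS'K
      (sep_subset _ _)
    have hxW : x ∈ O ∪ D := .inl (hS'O hxS')
    have hfreq := accPt_iff_frequently_nhdsNE.1 hacc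
    have hx0 : fderiv ℝ f₁ x = 0 := by
      by_contra hne
      have := (hf₁c x hxW).eventually_ne hne
      obtain ⟨y, hy1, hy2⟩ := (hfreq.and_eventually
        (this.filter_mono nhdsWithin_le_nhds)).exists
      exact hy2 hy1.2
    have hxN := hcritN x hxW hx0
    have hev := ha3 x (hS'O hxS') ((hgradN x hxN).1 hx0)
    have hNev : ∀ᶠ y in 𝓝[≠] x, y ∈ N := mem_nhdsWithin_of_mem_nhds (hNo.mem_nhds hxN)
    obtain ⟨y, ⟨hy1, hy2⟩, hy3⟩ := ((hfreq.and_eventually hev).and_eventually hNev).exists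
    exact hy2 ((hgradN y hy3).1 hy1.2)
  -- The critical points of `f₁ ∘ h⁻¹` are the images under `h` of those of `f₁`, and nothing
  -- changes outside `O`.
  obtain ⟨h, hh, hhZ⟩ := exists_isSupportedDiffeo_image_subset hO hconn hB hBne hBO hZfin
    ((sep_subset _ _).trans hS'O)
  have hsymm := hh.symm
  have hmaps : MapsTo h.symm (O ∪ D) (O ∪ D) := fun x hx => by
    by_cases hxO : x ∈ O
    · exact .inl (hsymm.mem_of_mem hxO)
    · rw [hsymm.eq_self hxO]; exact hx
  refine ⟨fun x => f₁ (h.symm x), hf₁.comp hh.contDiff_symm.contDiffOn hmaps, fun x hx => ?_,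
    fun x hx => ?_, fun x hx hx0 => ?_⟩
  · simp only [hsymm.eq_self hx.2, f₁, f₀, (χ2 x hx.2).self_of_nhds, (κ3 x hx.2).self_of_nhds]
    ring
  · have hy := hsymm.mem_of_mem hx
    by_cases hyS' : h.symm x ∈ S'
    · exact ha2 _ hyS'
    · have hev : ∀ᶠ y in 𝓝 (h.symm x), χ y = 0 := not_not.1 hyS'
      simp only [f₁, hev.self_of_nhds, zero_mul, add_zero]
      exact hf₀pos _ hy
  · set y := h.symm x with hy
    have hxy : x = h y := by rw [hy, Equiv.apply_symm_apply]
    have hyW : y ∈ O ∪ D := hmaps hx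
    have hdf : DifferentiableAt ℝ (fun x => f₁ (h.symm x)) (h y) := by
      rw [← hxy]
      exact DifferentiableAt.comp x (hf₁d y hyW).differentiableAt
        (hh.contDiff_symm.differentiable (by norm_num) x)
    have h1 : HasFDerivAt (fun z => f₁ (h.symm (h z)))
        ((fderiv ℝ (fun x => f₁ (h.symm x)) (h y)).comp (fderiv ℝ h y)) y :=
      HasFDerivAt.comp (g := fun x => f₁ (h.symm x)) y hdf.hasFDerivAt
        (hh.contDiff.differentiable (by norm_num) y).hasFDerivAt
    simp only [Equiv.symm_apply_apply] at h1
    rw [← hxy, hx0, ContinuousLinearMap.zero_comp] at h1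
    have hy0 : fderiv ℝ f₁ y = 0 := h1.fderiv
    rw [hxy]
    exact hhZ y ⟨hNS' (hcritN y hyW hy0), hy0⟩

end Morse

/-! ### Smooth dependence of upward zeros -/

section ExitTime

/-- The implicit function theorem for zeros that are crossed upwards: these are unique, and
depend smoothly on the parameter. -/
theorem exists_zero_crossing {E : Type} [NormedAddCommGroup E] [NormedSpace ℝ E] [CompleteSpace E]
    {G : E × ℝ → ℝ} (hG : ContDiff ℝ 2 G) {a b : ℝ}
    (hpos : ∀ w, ∀ s ∈ Ioo a b, G (w, s) = 0 → 0 < fderiv ℝ G (w, s) (0, 1)) :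
    ∃ (D : Set E) (τ : E → ℝ), IsOpen D ∧ ContDiffOn ℝ 2 τ D ∧
      (∀ w ∈ D, τ w ∈ Ioo a b ∧ G (w, τ w) = 0) ∧
      ∀ w, ∀ s ∈ Ioo a b, G (w, s) = 0 → w ∈ D ∧ τ w = s := by
  have hdiff : Differentiable ℝ G := hG.differentiable (by norm_num)
  have hder : ∀ w s, HasDerivAt (fun s => G (w, s)) (fderiv ℝ G (w, s) (0, 1)) s := fun w s =>
    (hdiff (w, s)).hasFDerivAt.comp_hasDerivAt s ((hasDerivAt_const s w).prodMk (hasDerivAt_id s))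
  have hlt : ∀ w, ∀ s ∈ Ioo a b, ∀ s' ∈ Ioo a b, G (w, s) = 0 → s < s' → 0 < G (w, s') := by
    intro w s hs s' hs' h0 hlt
    have hsub : ∀ u ∈ Icc s s', u ∈ Ioo a b := fun u hu =>
      ⟨hs.1.trans_le hu.1, hu.2.trans_lt hs'.2⟩
    exact pos_of_hasDerivWithinAt_pos_of_eq_zero (g := fun s => G (w, s)) (a := s) (b := s')
      (fun u _ => (hder w u).continuousAt.continuousWithinAt)
      (fun u hu hu0 => ⟨_, hpos w u (hsub u hu) hu0, (hder w u).hasDerivWithinAt⟩) h0.ge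
      ⟨hlt, le_rfl⟩
  have huniq : ∀ w, ∀ s ∈ Ioo a b, ∀ s' ∈ Ioo a b, G (w, s) = 0 → G (w, s') = 0 → s = s' := by
    intro w s hs s' hs' h0 h0'
    rcases lt_trichotomy s s' with h | h | h
    · linarith [hlt w s hs s' hs' h0 h]
    · exact h
    · linarith [hlt w s' hs' s hs h0' h]
  let D : Set E := {w | ∃ s ∈ Ioo a b, G (w, s) = 0}
  have hsel : ∀ w, ∃ s, w ∈ D → s ∈ Ioo a b ∧ G (w, s) = 0 := fun w => by
    by_cases hw : w ∈ D
    · obtain ⟨s, hs⟩ := hw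
      exact ⟨s, fun _ => hs⟩
    · exact ⟨0, fun h => absurd h hw⟩
  choose τ hτ using hsel
  have hloc : ∀ w ∈ D, D ∈ 𝓝 w ∧ ContDiffAt ℝ 2 τ w := by
    intro w hw
    obtain ⟨hs, h0⟩ := hτ w hw
    set s := τ w
    have cdf : ContDiffAt ℝ 2 G (w, s) := hG.contDiffAt
    have inv : (fderiv ℝ G (w, s) ∘L .inr ℝ E ℝ).IsInvertible := by
      refine ⟨ContinuousLinearEquiv.unitsEquivAut ℝ (Units.mk0 _ (hpos w s hs h0).ne'), ?_⟩
      ext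
      simp
    have hc := cdf.contDiffAt_implicitFunction (by norm_num) inv
    have hz := cdf.eventually_apply_implicitFunction (by norm_num) inv
    have hI : ∀ᶠ v in 𝓝 w, cdf.implicitFunction (by norm_num) inv v ∈ Ioo a b := by
      refine hc.continuousAt.eventually (isOpen_Ioo.mem_nhds ?_)
      rw [cdf.implicitFunction_apply_self (by norm_num) inv]
      exact hs
    -- Zeros being unique, the chosen τ must coincide with the local implicit function and inherits
    -- its smoothness.
    have hev : ∀ᶠ v in 𝓝 w, v ∈ D ∧ τ v = cdf.implicitFunction (by norm_num) inv v := by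
      filter_upwards [hz, hI] with v hv1 hv2
      rw [h0] at hv1
      have hvD : v ∈ D := ⟨_, hv2, hv1⟩
      exact ⟨hvD, huniq v _ (hτ v hvD).1 _ hv2 (hτ v hvD).2 hv1⟩
    exact ⟨hev.mono fun _ h => h.1, hc.congr_of_eventuallyEq (hev.mono fun _ h => h.2)⟩
  refine ⟨D, τ, isOpen_iff_mem_nhds.2 fun w hw => (hloc w hw).1,
    fun w hw => (hloc w hw).2.contDiffWithinAt, fun w hw => hτ w hw, fun w s hs h0 => ?_⟩
  have hw : w ∈ D := ⟨s, hs, h0⟩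
  exact ⟨hw, huniq w _ (hτ w hw).1 s hs (hτ w hw).2 h0⟩

end ExitTime

/-! ### Making the field outward on the boundary -/

section OutwardField

/-- On the compact part where a ≤ 0, b has a positive minimum; k = (M+1)/min b beats the bound M of
|a|. -/
lemma exists_pos_add_mul {Z : Type} [TopologicalSpace Z] [T2Space Z] {A : Set Z}
    (hA : IsCompact A)
    {a b : Z → ℝ} (ha : ContinuousOn a A) (hb : ContinuousOn b A) (hb0 : ∀ z ∈ A, 0 ≤ b z)
    (hab : ∀ z ∈ A, b z = 0 → 0 < a z) : ∃ k : ℝ, ∀ z ∈ A, 0 < a z + k * b z := by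
  have hA' : IsCompact (A ∩ a ⁻¹' Iic 0) :=
    hA.of_isClosed_subset (ha.preimage_isClosed_of_isClosed hA.isClosed isClosed_Iic)
      inter_subset_left
  rcases (A ∩ a ⁻¹' Iic 0).eq_empty_or_nonempty with he | hne
  · refine ⟨0, fun z hz => ?_⟩
    by_contra h
    have : z ∈ A ∩ a ⁻¹' Iic 0 := ⟨hz, by simpa using h⟩
    simp [he] at this
  · obtain ⟨z₀, hz₀, hmin⟩ := hA'.exists_isMinOn hne (hb.mono inter_subset_left)
    have hm : 0 < b z₀ := (hb0 z₀ hz₀.1).lt_of_ne fun h =>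
      (hab z₀ hz₀.1 h.symm).not_ge hz₀.2
    obtain ⟨M, hM⟩ := hA.exists_bound_of_continuousOn ha
    have hM0 : 0 ≤ M := (norm_nonneg _).trans (hM z₀ hz₀.1)
    refine ⟨(M + 1) / b z₀, fun z hz => ?_⟩
    have hk : 0 < (M + 1) / b z₀ := by positivity
    rcases lt_or_ge 0 (a z) with h | h
    · have := mul_nonneg hk.le (hb0 z hz)
      linarith
    · have h1 : b z₀ ≤ b z := hmin ⟨hz, h⟩
      have h2 : (M + 1) / b z₀ * b z₀ = M + 1 := div_mul_cancel₀ _ hm.ne'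
      have h3 := mul_le_mul_of_nonneg_left h1 hk.le
      have h4 := (abs_le.1 ((Real.norm_eq_abs _).symm.le.trans (hM z hz))).1
      linarith

/-- A compactly supported field on space-time which coincides with a given one on `[0,T] × Ω`,
points outwards along the boundary of `O`, and vanishes on `B`. -/
theorem exists_outward_field {T : ℝ} (hT : 0 < T) {Ω O B : Set Plane} {r : Plane → ℝ}
    (hr : IsGlobalDefiningFunction (3 : ℕ) O r) (hbdd : Bornology.IsBounded O) (hΩO : Ω ⊆ O)
    {Y : ℝ × Plane → Plane} (hY : ContDiff ℝ 2 Y)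
    (hpos : ∀ t ∈ Icc 0 T, ∀ x ∈ frontier O ∩ closure Ω, 0 < fderiv ℝ r x (Y (t, x)))
    (hB : IsClosed B) (hB1 : Disjoint B (closure Ω ∪ frontier O)) :
    ∃ V : ℝ × Plane → Plane, ContDiff ℝ 2 V ∧ HasCompactSupport V ∧
      (∀ t ∈ Icc 0 T, ∀ x ∈ Ω, V (t, x) = Y (t, x)) ∧ (∀ t, ∀ x ∈ B, V (t, x) = 0) ∧
      ∃ δ > 0, ∀ t ∈ Ioo (-δ) (T + δ), ∀ x ∈ frontier O, 0 < fderiv ℝ r x (V (t, x)) := by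
  have hfrc : IsCompact (frontier O) := Metric.isCompact_of_isClosed_isBounded isClosed_frontier
    (hbdd.closure.subset frontier_subset_closure)
  obtain ⟨ζ, ζ1, ζ2, ζ3⟩ := (isClosed_closure (s := Ω)).isOpen_compl.exists_contDiff_support_eq
    (n := ⊤)
  have ζ2' : ContDiff ℝ 2 ζ := ζ2.of_le (natCast_le_smooth 2)
  have hζ0 : ∀ x, 0 ≤ ζ x := fun x => (ζ3 ⟨x, rfl⟩).1
  have hζ : ∀ x, ζ x = 0 ↔ x ∈ closure Ω := fun x => by
    rw [← not_iff_not, ← mem_compl_iff, ← ζ1]; rfl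
  have hgrad : ContDiff ℝ 2 (gradient r) := contDiff_gradient hr.contDiff (by norm_num)
  have hfd : Continuous (fderiv ℝ r) := hr.contDiff.continuous_fderiv (by norm_num)
  obtain ⟨k, hk⟩ := exists_pos_add_mul (isCompact_Icc.prod hfrc)
    (A := Icc 0 T ×ˢ frontier O) (a := fun z => fderiv ℝ r z.2 (Y z))
    (b := fun z => ζ z.2 * ‖gradient r z.2‖ ^ 2)
    (Continuous.continuousOn (by
      have := hY.continuous
      fun_prop))
    (Continuous.continuousOn (by
      have := ζ2'.continuous
      have := hgrad.continuous
      fun_prop))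
    (fun z _ => mul_nonneg (hζ0 _) (sq_nonneg _))
    (fun z hz h0 => by
      have hne := norm_pos_iff.2 (gradient_ne_zero_iff.2 (hr.fderiv_ne z.2 hz.2))
      have hz0 : ζ z.2 = 0 := by
        rcases mul_eq_zero.1 h0 with h | h
        · exact h
        · exact absurd h (by positivity)
      exact hpos z.1 hz.1 z.2 ⟨hz.2, (hζ _).1 hz0⟩)
  obtain ⟨θ, θ1, θ2, θ3, -⟩ := exists_contDiff_zero_one_nhds hB
    (isClosed_closure.union isClosed_frontier) hB1
  have θ1' : ContDiff ℝ 2 θ := θ1.of_le (natCast_le_smooth 2)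
  obtain ⟨R, hR⟩ := hbdd.closure.subset_closedBall (0 : Plane)
  have hR' : 0 < max R (T + 1) := lt_max_of_lt_right (by linarith)
  let χ : ContDiffBump (0 : ℝ × Plane) := ⟨max R (T + 1), max R (T + 1) + 1, hR', by linarith⟩
  have hχ : ∀ t ∈ Icc (-1) (T + 1), ∀ x ∈ closure O, χ (t, x) = 1 := fun t ht x hx => by
    refine χ.one_of_mem_closedBall ?_
    rw [mem_closedBall_zero_iff, Prod.norm_def]
    refine max_le_max ?_ ?_ |>.trans (max_comm _ _).le
    · rw [Real.norm_eq_abs, abs_le]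
      exact ⟨by linarith [ht.1], ht.2⟩
    · simpa using hR hx
  -- `ζ` vanishes exactly on the closure of Ω, so the correction along `gradient r` acts only
  -- outside it; `θ` kills the field on `B`, `χ` makes the support compact.
  let V : ℝ × Plane → Plane := fun z => χ z • θ z.2 • (Y z + (k * ζ z.2) • gradient r z.2)
  have hV : ContDiff ℝ 2 V := by
    refine χ.contDiff.smul ((θ1'.comp contDiff_snd).smul (hY.add ?_))
    exact (contDiff_const.mul (ζ2'.comp contDiff_snd)).smul (hgrad.comp contDiff_snd)
  have hpos' : ∀ t ∈ Icc 0 T, ∀ x ∈ frontier O, 0 < fderiv ℝ r x (V (t, x)) := by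
    intro t ht x hx
    have h1 := hk (t, x) ⟨ht, hx⟩
    simp only [V, hχ t ⟨by linarith [ht.1], by linarith [ht.2]⟩ x (frontier_subset_closure hx),
      (θ3 x (.inr hx)).self_of_nhds, one_smul, map_add, map_smul, fderiv_apply_gradient,
      smul_eq_mul]
    simpa [mul_assoc] using h1
  have hev : ∀ t ∈ Icc 0 T, ∀ᶠ s in 𝓝 t, ∀ x ∈ frontier O, 0 < fderiv ℝ r x (V (s, x)) := by
    intro t ht
    refine hfrc.eventually_forall_of_forall_eventually fun x hx => ?_
    have hc : Continuous fun z : ℝ × Plane => fderiv ℝ r z.2 (V (z.1, z.2)) := by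
      have := hV.continuous
      fun_prop
    exact (hc.tendsto (t, x)).eventually (lt_mem_nhds (hpos' t ht x hx))
  refine ⟨V, hV, χ.hasCompactSupport.smul_right, fun t ht x hx => ?_, fun t x hx => ?_, ?_⟩
  · simp only [V, hχ t ⟨by linarith [ht.1], by linarith [ht.2]⟩ x (subset_closure (hΩO hx)),
      (θ3 x (.inl (subset_closure hx))).self_of_nhds, (hζ x).2 (subset_closure hx), one_smul,
      mul_zero, zero_smul, add_zero]
  · simp only [V, (θ2 x hx).self_of_nhds, zero_smul, smul_zero]
  -- The margin beyond [0,T] makes exit times equal to 0 or T interior, so that the weight is C² up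
  -- to t = 0 and t = T.
  · obtain ⟨δ₁, hδ₁, h1⟩ := Metric.eventually_nhds_iff.1 (hev 0 ⟨le_rfl, hT.le⟩)
    obtain ⟨δ₂, hδ₂, h2⟩ := Metric.eventually_nhds_iff.1 (hev T ⟨hT.le, le_rfl⟩)
    refine ⟨min δ₁ δ₂, lt_min hδ₁ hδ₂, fun t ht => ?_⟩
    have m1 := min_le_left δ₁ δ₂
    have m2 := min_le_right δ₁ δ₂
    rcases lt_or_ge t 0 with h | h
    · exact h1 (by rw [Real.dist_eq, sub_zero, abs_lt]; exact ⟨by linarith [ht.1], by linarith⟩)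
    · rcases le_or_gt t T with h' | h'
      · exact hpos' t ⟨h, h'⟩
      · exact h2 (by rw [Real.dist_eq, abs_lt]; exact ⟨by linarith, by linarith [ht.2]⟩)

end OutwardField

/-! ### Evolution of a time-dependent field -/

section Evolution

/-- `e s (t, x)` is the position at time `s` of the particle carried by `V` which is at `x` at
time `t`. -/
structure IsEvolution (V : ℝ × Plane → Plane) (e : ℝ → ℝ × Plane → Plane) : Prop where
  contDiff : ContDiff ℝ 2 (Function.uncurry e)
  self : ∀ t x, e t (t, x) = x
  deriv : ∀ z s, HasDerivAt (fun s => e s z) (V (s, e s z)) s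
  trans : ∀ s u z, e s (u, e u z) = e s z
  eq_self : ∀ x, (∀ t, V (t, x) = 0) → ∀ s t, e s (t, x) = x

theorem exists_isEvolution {V : ℝ × Plane → Plane} (hV : ContDiff ℝ 2 V)
    (hVs : HasCompactSupport V) : ∃ e, IsEvolution V e := by
  -- The field is made autonomous by treating time as a coordinate of speed 1.
  let F : ℝ × Plane → ℝ × Plane := fun z => (1, V z)
  have hF : ContDiff ℝ (2 : ℕ) F := contDiff_const.prodMk hV
  obtain ⟨K, hK⟩ := hV.lipschitzWith_of_hasCompactSupport hVs (by norm_num)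
  have hL : LipschitzWith (max 0 K) F := (LipschitzWith.const (1 : ℝ)).prodMk hK
  obtain ⟨M, hM⟩ := hVs.exists_bound_of_continuous hV.continuous
  obtain ⟨φ, hφ⟩ := exists_isGlobalFlow (M := max 1 M) hL fun z => by
    simp only [F, Prod.norm_def, norm_one]
    exact max_le_max le_rfl (hM z)
  have hc := hφ.contDiff hL (by norm_num) hF
  have hfst : ∀ s z, (φ s z).1 = z.1 + s := by
    intro s z
    have hd : ∀ s, HasDerivAt (fun s => (φ s z).1 - s) 0 s := fun s => by
      have h := ((ContinuousLinearMap.fst ℝ ℝ Plane).hasFDerivAt.comp_hasDerivAt s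
        (hφ.deriv z s)).sub (hasDerivAt_id s)
      simpa [F, Function.comp_def, Pi.sub_def] using h
    have := is_const_of_deriv_eq_zero (fun s => (hd s).differentiableAt)
      (fun s => (hd s).deriv) s 0
    simp only [hφ.zero, sub_zero] at this
    linarith
  have hpair : ∀ s z, φ (s - z.1) z = (s, (φ (s - z.1) z).2) := fun s z =>
    Prod.ext (by simp [hfst]) rfl
  refine ⟨fun s z => (φ (s - z.1) z).2, ?_, fun t x => by simp [hφ.zero], fun z s => ?_,
    fun s u z => ?_, fun x hx s t => ?_⟩
  · have h1 : ContDiff ℝ 2 fun p : ℝ × ℝ × Plane => (p.1 - p.2.1, p.2) := by fun_prop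
    exact contDiff_snd.comp (hc.comp h1)
  · have h1 := ((ContinuousLinearMap.snd ℝ ℝ Plane).hasFDerivAt.comp_hasDerivAt (s - z.1)
      (hφ.deriv z (s - z.1))).comp_sub_const s z.1
    rw [hpair s z] at h1
    exact h1
  · rw [← hpair, ← hφ.add hL, hfst,
      (by ring : s - (z.1 + (u - z.1)) + (u - z.1) = s - z.1)]
  · have h1 : ∀ u, HasDerivAt (fun u : ℝ => ((t + u, x) : ℝ × Plane)) (F (t + u, x)) u := fun u => by
      simp only [F, hx]
      exact ((hasDerivAt_id u).const_add t).prodMk (hasDerivAt_const u x)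
    have := hφ.eq_of_integralCurve hL h1 (s - t)
    simp only [add_zero] at this
    simp [← this]

end Evolution

/-! ### Exit time and the function to be transported -/

section Exit

variable {V : ℝ × Plane → Plane} {e : ℝ → ℝ × Plane → Plane} {O : Set Plane} {r : Plane → ℝ}

lemma IsEvolution.hasDerivAt_comp (he : IsEvolution V e) (hr : IsGlobalDefiningFunction (3 : ℕ) O r)
    (z : ℝ × Plane) (s : ℝ) :
    HasDerivAt (fun s => r (e s z)) (fderiv ℝ r (e s z) (V (s, e s z))) s :=
  ((hr.differentiable (by norm_num)) (e s z)).hasFDerivAt.comp_hasDerivAt s (he.deriv z s)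

/-- The time at which the particle that is at `w` at time `T` crosses the boundary of `O`. -/
theorem IsEvolution.exists_exit_time (he : IsEvolution V e)
    (hr : IsGlobalDefiningFunction (3 : ℕ) O r) {T δ : ℝ} (hT : 0 < T) (hδ : 0 < δ)
    (hV : ∀ t ∈ Ioo (-δ) (T + δ), ∀ x ∈ frontier O, 0 < fderiv ℝ r x (V (t, x))) :
    ∃ (D : Set Plane) (τ : Plane → ℝ), IsOpen D ∧ ContDiffOn ℝ 2 τ D ∧
      (∀ t ∈ Ioo (-δ) (T + δ), ∀ x ∈ frontier O, e T (t, x) ∈ D ∧ τ (e T (t, x)) = t) ∧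
      (∀ x ∈ D ∩ O, T < τ x) ∧ ∀ x ∈ D, fderiv ℝ τ x ≠ 0 := by
  have hTI : T ∈ Ioo (-δ) (T + δ) := ⟨by linarith, by linarith⟩
  let G : Plane × ℝ → ℝ := fun p => r (e p.2 (T, p.1))
  have hG : ContDiff ℝ 2 G := by
    have h1 : ContDiff ℝ 2 fun p : Plane × ℝ => ((p.2, T, p.1) : ℝ × ℝ × Plane) := by fun_prop
    exact (hr.contDiff.of_le (by norm_num)).comp (he.contDiff.comp h1)
  have hpos : ∀ w, ∀ s ∈ Ioo (-δ) (T + δ), G (w, s) = 0 → 0 < fderiv ℝ G (w, s) (0, 1) := by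
    intro w s hs h0
    have h1 : HasDerivAt (fun s => G (w, s)) (fderiv ℝ G (w, s) (0, 1)) s :=
      (hG.differentiable (by norm_num) (w, s)).hasFDerivAt.comp_hasDerivAt s
        ((hasDerivAt_const s w).prodMk (hasDerivAt_id s))
    rw [h1.unique (he.hasDerivAt_comp hr (T, w) s)]
    exact hV s hs _ ((hr.mem_frontier_iff _).2 h0)
  obtain ⟨D, τ, hD, hτ, hDτ, huniq⟩ := exists_zero_crossing hG hpos
  have hfr : ∀ t ∈ Ioo (-δ) (T + δ), ∀ x ∈ frontier O, e T (t, x) ∈ D ∧ τ (e T (t, x)) = t :=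
    fun t ht x hx => huniq _ t ht (by
      simp only [G, he.trans, he.self]
      exact (hr.mem_frontier_iff x).1 hx)
  refine ⟨D, τ, hD, hτ, hfr, fun w hw => ?_, fun w hw h0 => ?_⟩
  · by_contra hcon
    push Not at hcon
    obtain ⟨hI, hz⟩ := hDτ w hw.1
    have hneg : G (w, T) < 0 := by
      simp only [G, he.self]
      exact (hr.mem_iff w).1 hw.2
    rcases hcon.eq_or_lt with h | h
    · rw [h] at hz
      exact hneg.ne hz
    · have := pos_of_hasDerivWithinAt_pos_of_eq_zero (g := fun s => G (w, s)) (a := τ w) (b := T)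
        (fun u _ => (he.hasDerivAt_comp hr (T, w) u).continuousAt.continuousWithinAt)
        (fun u hu hu0 => ⟨_, hV u ⟨hI.1.trans_le hu.1, hu.2.trans_lt hTI.2⟩ _
          ((hr.mem_frontier_iff _).2 hu0), (he.hasDerivAt_comp hr (T, w) u).hasDerivWithinAt⟩)
        hz.ge ⟨h, le_rfl⟩
      exact lt_asymm hneg this
  -- Following the particles that pass through the exit point `p` at varying times σ, one has τ(e T
  -- (σ, p)) = σ, whose derivative 1 excludes a critical point.
  · obtain ⟨hI, hz⟩ := hDτ w hw
    set p := e (τ w) (T, w) with hp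
    have hpf : p ∈ frontier O := (hr.mem_frontier_iff _).2 hz
    have hcw : e T (τ w, p) = w := by rw [hp, he.trans, he.self]
    have hcd : DifferentiableAt ℝ (fun σ => e T (σ, p)) (τ w) := by
      have h1 : ContDiff ℝ 2 fun σ : ℝ => ((T, σ, p) : ℝ × ℝ × Plane) := by fun_prop
      exact (he.contDiff.comp h1).differentiable (by norm_num) _
    have hτd : HasFDerivAt τ (0 : Plane →L[ℝ] ℝ) (e T (τ w, p)) := by
      rw [hcw, ← h0]
      exact ((hτ.contDiffAt (hD.mem_nhds hw)).differentiableAt (by norm_num)).hasFDerivAt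
    have h1 := hτd.comp_hasDerivAt (τ w) hcd.hasDerivAt
    have h2 : HasDerivAt (τ ∘ fun σ => e T (σ, p)) 1 (τ w) := by
      refine (hasDerivAt_id (τ w)).congr_of_eventuallyEq ?_
      filter_upwards [isOpen_Ioo.mem_nhds hI] with σ hσ using (hfr σ hσ p hpf).2
    simpa using h1.unique h2

/-- Functions whose transport by the evolution is a weight on `[0,T] × closure O`. -/
theorem IsEvolution.exists_transported_function (he : IsEvolution V e)
    (hr : IsGlobalDefiningFunction (3 : ℕ) O r) (hconn : IsConnected O)
    (hbdd : Bornology.IsBounded O) {T δ : ℝ} (hT : 0 < T) (hδ : 0 < δ)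
    (hV : ∀ t ∈ Ioo (-δ) (T + δ), ∀ x ∈ frontier O, 0 < fderiv ℝ r x (V (t, x)))
    {B : Set Plane} (hB : IsOpen B) (hBne : B.Nonempty) (hBO : B ⊆ O) :
    ∃ (U : Set Plane) (f : Plane → ℝ) (c : ℝ → ℝ), IsOpen U ∧ ContDiffOn ℝ 2 f U ∧
      (∀ x ∈ U, fderiv ℝ f x = 0 → x ∈ B) ∧ ∀ t ∈ Icc 0 T,
        (∀ x ∈ closure O, e T (t, x) ∈ U ∧ f (e T (t, x)) ∈ Icc 0 1 ∧ c t ≤ f (e T (t, x))) ∧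
        ∀ x ∈ frontier O, f (e T (t, x)) = c t := by
  obtain ⟨D, τ, hD, hτ, hfr, hDO, hτ'⟩ := he.exists_exit_time hr hT hδ hV
  have hsub : ∀ t ∈ Icc 0 T, t ∈ Ioo (-δ) (T + δ) := fun t ht =>
    ⟨by linarith [ht.1], by linarith [ht.2]⟩
  obtain ⟨f, hf, hfD, hfO, hfc⟩ := exists_contDiffOn_critical_subset hr.isOpen
    hconn.isPreconnected hbdd hD
    (fun x hx => by
      have := (hfr T (hsub T ⟨hT.le, le_rfl⟩) x hx).1
      rwa [he.self] at this) hτ hτ' hDO hB hBne hBO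
  have hU : IsOpen (O ∪ D) := hr.isOpen.union hD
  have hbd : ∀ t ∈ Icc 0 T, ∀ x ∈ frontier O,
      e T (t, x) ∈ O ∪ D ∧ f (e T (t, x)) = t := by
    intro t ht x hx
    obtain ⟨h1, h2⟩ := hfr t (hsub t ht) x hx
    refine ⟨.inr h1, ?_⟩
    rw [hfD _ ⟨h1, fun h => ?_⟩, h2]
    have := hDO _ ⟨h1, h⟩
    linarith [ht.2]
  -- A particle still in `O` at time `T` has value above `T`; any other crosses the boundary at some
  -- s in [t,T] and has value s.
  have hcl : ∀ t ∈ Icc 0 T, ∀ x ∈ closure O, e T (t, x) ∈ O ∪ D ∧ t ≤ f (e T (t, x)) := by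
    intro t ht x hx
    by_cases hw : e T (t, x) ∈ O
    · exact ⟨.inl hw, ht.2.trans (hfO _ hw).le⟩
    · have hcont : ContinuousOn (fun s => r (e s (t, x))) (Icc t T) := fun s _ =>
        (he.hasDerivAt_comp hr (t, x) s).continuousAt.continuousWithinAt
      have h0 : (0 : ℝ) ∈ Icc (r (e t (t, x))) (r (e T (t, x))) := by
        rw [he.self]
        exact ⟨hr.mem_closure_iff.1 hx, not_lt.1 fun h => hw ((hr.mem_iff _).2 h)⟩
      obtain ⟨s, hs, hs0⟩ := intermediate_value_Icc ht.2 hcont h0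
      have := hbd s ⟨ht.1.trans hs.1, hs.2⟩ _ ((hr.mem_frontier_iff _).2 hs0)
      rw [he.trans] at this
      exact ⟨this.1, this.2.symm ▸ hs.1⟩
  have heT : Continuous (e T) := he.contDiff.continuous.comp (Continuous.prodMk_right T)
  obtain ⟨M, hM⟩ := (isCompact_Icc (a := (0 : ℝ)) (b := T)).prod
      (Metric.isCompact_of_isClosed_isBounded isClosed_closure hbdd.closure)
    |>.exists_bound_of_continuousOn (f := fun z => f (e T z))
      (hf.continuousOn.comp heT.continuousOn fun z hz => (hcl z.1 hz.1 z.2 hz.2).1)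
  have hM0 : 0 < max M 1 := lt_max_of_lt_right one_pos
  refine ⟨O ∪ D, fun x => f x / max M 1, fun t => t / max M 1, hU, hf.div_const _,
    fun x hx h => hfc x hx ?_, fun t ht => ⟨fun x hx => ?_, fun x hx => ?_⟩⟩
  · have hd := (hf.contDiffAt (hU.mem_nhds hx)).differentiableAt (by norm_num)
    have h1 := (hd.hasFDerivAt.mul_const (max M 1)⁻¹).fderiv
    simp only [← div_eq_mul_inv, h] at h1
    exact (smul_eq_zero.1 h1.symm).resolve_left (inv_ne_zero hM0.ne')
  · obtain ⟨h1, h2⟩ := hcl t ht x hx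
    have h3 := (le_abs_self _).trans (hM (t, x) ⟨ht, hx⟩)
    exact ⟨h1, ⟨div_nonneg (ht.1.trans h2) hM0.le,
      div_le_one_of_le₀ (h3.trans (le_max_left _ _)) hM0.le⟩,
      div_le_div_of_nonneg_right h2 hM0.le⟩
  · simp only [(hbd t ht x hx).2]

end Exit

/-! ### The transported weight -/

section Weight

/-- The normal derivative is nonpositive at a boundary point where the minimum is attained. -/
lemma inner_gradientWithin_nonpos_of_isMinOn {O : Set Plane} (hO : IsOpen O) {g : Plane → ℝ}
    {x ν : Plane} (hx : x ∈ frontier O) (hν : IsOuterNormal O x ν)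
    (hg : DifferentiableWithinAt ℝ g (closure O) x) (hmin : IsMinOn g (closure O) x) :
    inner ℝ (gradientWithin g (closure O) x) ν ≤ 0 := by
  rw [inner_gradientWithin_left]
  obtain ⟨hν1, ρ, ⟨hρ, -, hloc⟩, c, hc, hgrad⟩ := hν
  have h0 : ρ x = 0 := by
    refine le_antisymm ?_ (not_lt.1 fun h => ?_)
    · by_contra hpos
      push Not at hpos
      obtain ⟨z, hz, h1, h2⟩ := ((mem_closure_iff_frequently.1 (frontier_subset_closure hx)).and_eventually
        (hloc.and ((hρ.continuous.tendsto x).eventually (lt_mem_nhds hpos)))).exists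
      exact lt_asymm (h1.1 hz) h2
    · exact hO.inter_frontier_eq.le ⟨hloc.self_of_nhds.2 h, hx⟩
  have hcont : Continuous fun t : ℝ => x + t • (-ν) := by fun_prop
  have hx0 : x + (0 : ℝ) • (-ν) = x := by simp
  have hneg : fderiv ℝ ρ x (-ν) < 0 := by
    rw [map_neg, ← inner_gradient_left, hgrad, real_inner_smul_left, real_inner_self_eq_norm_sq,
      hν1]
    linarith
  have hin : ∀ᶠ t : ℝ in 𝓝[>] 0, x + t • (-ν) ∈ closure O := by
    have h1 := ((hcont.tendsto' 0 x hx0).mono_left (nhdsWithin_le_nhds (s := Ioi 0))).eventually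
      hloc
    filter_upwards [h1, eventually_neg_of_fderiv_neg (hρ.differentiable one_ne_zero x) h0 hneg]
      with t h1 h2 using subset_closure (h1.2 h2)
  have hγ : HasDerivWithinAt (fun t : ℝ => x + t • (-ν)) (-ν)
      ((fun t : ℝ => x + t • (-ν)) ⁻¹' closure O) 0 := by
    simpa using (((hasDerivAt_id (0 : ℝ)).smul_const (-ν)).const_add x).hasDerivWithinAt
  have hd : HasFDerivWithinAt g (fderivWithin ℝ g (closure O) x) (closure O)
      (x + (0 : ℝ) • (-ν)) := by
    rw [hx0]
    exact hg.hasFDerivWithinAt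
  -- The inward ray stays in the closure for small t > 0, so `g` has a right derivative along it,
  -- nonnegative by minimality.
  have hcomp := (hd.comp_hasDerivWithinAt 0 hγ (mapsTo_preimage _ _)).mono_of_mem_nhdsWithin
    (s := Ioi 0) hin
  rw [hasDerivWithinAt_iff_tendsto_slope' self_notMem_Ioi] at hcomp
  have := ge_of_tendsto hcomp (b := 0) (by
    filter_upwards [hin, self_mem_nhdsWithin] with t ht ht0
    have ht0' : (0 : ℝ) < t := ht0
    rw [slope_def_field, Function.comp_apply, Function.comp_apply, hx0, sub_zero]
    exact div_nonneg (sub_nonneg.2 (hmin ht)) ht0'.le)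
  rw [map_neg] at this
  linarith

theorem exists_isTransportedWeight {T δ : ℝ} (hT : 0 < T) (hδ : 0 < δ) {Ω O B : Set Plane}
    {r : Plane → ℝ} (hr : IsGlobalDefiningFunction (3 : ℕ) O r) (hconn : IsConnected O)
    (hbdd : Bornology.IsBounded O) (hΩO : Ω ⊆ O) {y : ℝ → Plane → Plane}
    {V : ℝ × Plane → Plane} (hV : ContDiff ℝ 2 V) (hVs : HasCompactSupport V)
    (hVy : ∀ t ∈ Icc 0 T, ∀ x ∈ Ω, V (t, x) = y t x)
    (hout : ∀ t ∈ Ioo (-δ) (T + δ), ∀ x ∈ frontier O, 0 < fderiv ℝ r x (V (t, x)))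
    (hB : IsOpen B) (hBne : B.Nonempty) (hBO : B ⊆ O) (hVB : ∀ t, ∀ x ∈ B, V (t, x) = 0) :
    ∃ ψ : ℝ → Plane → ℝ, IsTransportedWeight T Ω O B y ψ := by
  obtain ⟨e, he⟩ := exists_isEvolution hV hVs
  obtain ⟨U, f, c, hU, hf, hcrit, hfc⟩ :=
    he.exists_transported_function hr hconn hbdd hT hδ hout hB hBne hBO
  have heT : ContDiff ℝ 2 (e T) := he.contDiff.comp (contDiff_const.prodMk contDiff_id)
  let h : ℝ × Plane → ℝ := fun z => f (e T z)
  have hreg : ∀ t ∈ Icc 0 T, ∀ x ∈ closure O, ContDiffAt ℝ 2 h (t, x) := fun t ht x hx =>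
    (hf.contDiffAt (hU.mem_nhds ((hfc t ht).1 x hx).1)).comp _ heT.contDiffAt
  have hhd : ∀ t ∈ Icc 0 T, ∀ x ∈ closure O, HasFDerivAt h (fderiv ℝ h (t, x)) (t, x) :=
    fun t ht x hx => ((hreg t ht x hx).differentiableAt (by norm_num)).hasFDerivAt
  have hsp : ∀ t ∈ Icc 0 T, ∀ x ∈ closure O, HasFDerivAt (fun x => h (t, x))
      (fderiv ℝ h (t, x) ∘L .inr ℝ ℝ Plane) x := fun t ht x hx =>
    (hhd t ht x hx).comp x (hasFDerivAt_prodMk_right t x)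
  have hcontx : ∀ t ∈ Icc 0 T, ∀ x ∈ closure O, ContinuousAt (fun x => h (t, x)) x :=
    fun t ht x hx => (hsp t ht x hx).continuousAt
  refine ⟨fun t x => h (t, x), ⟨fun z hz => (hreg z.1 hz.1 z.2 hz.2).contDiffWithinAt, ?_,
    fun t ht x hx => ((hfc t ht).1 x hx).2.1, ?_, ?_, ?_⟩⟩
  · intro t ht x hx
    have ht' := Ioo_subset_Icc_self ht
    have hxO : x ∈ closure O := subset_closure (hΩO hx)
    have h1 : HasDerivAt (fun s => h (s, x)) (fderiv ℝ h (t, x) (1, 0)) t :=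
      HasFDerivAt.comp_hasDerivAt (f := fun s => (s, x)) t (hhd t ht' x hxO)
        ((hasDerivAt_id t).prodMk (hasDerivAt_const t x))
    have h2 : HasDerivAt (fun s => h (s, e s (t, x))) (fderiv ℝ h (t, x) (1, V (t, x))) t := by
      have hd := he.deriv (t, x) t
      rw [he.self] at hd
      refine HasFDerivAt.comp_hasDerivAt (f := fun s => (s, e s (t, x))) (l := h) t ?_
        ((hasDerivAt_id t).prodMk hd)
      simpa only [id, he.self] using hhd t ht' x hxO
    -- Along a trajectory the final position does not change; differentiating this constancy at s =
    -- t is the transport equation.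
    have h3 : (fun s => h (s, e s (t, x))) = fun _ => h (t, x) := by
      funext s
      simp only [h, he.trans]
    rw [h3] at h2
    have h4 := h2.unique (hasDerivAt_const t _)
    rw [h1.deriv, real_inner_comm, inner_gradient_left, (hsp t ht' x hxO).fderiv,
      ← hVy t ht' x hx, ← h4]
    simp [← map_add]
  · intro t ht x hx ν hν
    have ht' := Ioo_subset_Icc_self ht
    have hxO := frontier_subset_closure hx
    exact inner_gradientWithin_nonpos_of_isMinOn hr.isOpen hx hν
      (hsp t ht' x hxO).differentiableAt.differentiableWithinAt fun z hz =>
        ((hfc t ht').2 x hx).le.trans ((hfc t ht').1 z hz).2.2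
  · intro t ht
    refine ⟨c t, (hfc t ht).2, ?_, fun b hb => ?_⟩
    · rintro _ ⟨x, hx, rfl⟩
      exact ((hfc t ht).1 x (subset_closure hx)).2.2
    · obtain ⟨x, hx⟩ : (frontier O).Nonempty := nonempty_frontier_iff.2 ⟨hconn.nonempty, fun h =>
        NormedSpace.unbounded_univ ℝ Plane (h ▸ hbdd)⟩
      rw [← (hfc t ht).2 x hx]
      have hxO := frontier_subset_closure hx
      exact ContinuousWithinAt.closure_le hxO continuousWithinAt_const
        (hcontx t ht x hxO).continuousWithinAt fun z hz => hb ⟨z, hz, rfl⟩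
  · have hne : ∀ t ∈ Icc 0 T, ∀ x ∈ closure O \ B,
        0 < ‖fderiv ℝ h (t, x) ∘L .inr ℝ ℝ Plane‖ := by
      intro t ht x hx
      rw [norm_pos_iff]
      intro h0
      have hw := ((hfc t ht).1 x hx.1).1
      have hback : ∀ w, h (t, e t (T, w)) = f w := fun w => by
        simp only [h, he.trans, he.self]
      have hbx : e t (T, e T (t, x)) = x := by rw [he.trans, he.self]
      have hed : DifferentiableAt ℝ (fun w => e t (T, w)) (e T (t, x)) := by
        have h1 : ContDiff ℝ 2 fun w : Plane => ((t, T, w) : ℝ × ℝ × Plane) := by fun_prop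
        exact (he.contDiff.comp h1).differentiable (by norm_num) _
      have h2 := hsp t ht x hx.1
      rw [h0] at h2
      replace h2 : HasFDerivAt (fun x => h (t, x)) (0 : Plane →L[ℝ] ℝ) (e t (T, e T (t, x))) := by
        rwa [hbx]
      have h3 := (h2.comp (e T (t, x)) hed.hasFDerivAt).fderiv
      have h4 : (fun x => h (t, x)) ∘ (fun w => e t (T, w)) = f := funext hback
      rw [h4, ContinuousLinearMap.zero_comp] at h3
      -- A critical point at time t sits over one of `f`, which lies in `B`; particles of `B` are at
      -- rest, so x itself is in `B`.
      have hwB := hcrit _ hw h3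
      have h5 := he.eq_self _ (fun s => hVB s _ hwB) t T
      rw [hbx] at h5
      exact hx.2 (h5 ▸ hwB)
    have hcpt : IsCompact (Icc 0 T ×ˢ (closure O \ B)) := isCompact_Icc.prod
      ((Metric.isCompact_of_isClosed_isBounded isClosed_closure hbdd.closure).diff hB)
    obtain ⟨α, hα, hle⟩ := hcpt.exists_forall_le'
      (f := fun z => ‖fderiv ℝ h z ∘L .inr ℝ ℝ Plane‖)
      (fun z hz => by
        have h1 := (hreg z.1 hz.1 z.2 hz.2.1).continuousAt_fderiv (by norm_num)
        exact (h1.clm_comp continuousAt_const).norm.continuousWithinAt)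
      (fun z hz => hne z.1 hz.1 z.2 hz.2)
    refine ⟨α, hα, fun t ht x hx => ?_⟩
    have ht' := Ioo_subset_Icc_self ht
    have hxO := subset_closure hx.1
    rw [gradient, LinearIsometryEquiv.norm_map, (hsp t ht' x hxO).fderiv]
    exact hle (t, x) ⟨ht', hxO, hx.2⟩

end Weight

theorem lemma4p1
    (T : ℝ) (hT : 0 < T)
    (Ω : Set Plane) (hΩ : IsBoundedDomainOfClass ((⊤ : ℕ∞) : WithTop ℕ∞) Ω)
    -- the target density and velocity
    (σ : ℝ → Plane → ℝ) (y : ℝ → Plane → Plane)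
    (hσ : ContDiffOn ℝ 2 (Function.uncurry σ) (Icc 0 T ×ˢ closure Ω))
    (hσpos : ∃ m : ℝ, 0 < m ∧ ∀ t ∈ Icc 0 T, ∀ x ∈ closure Ω, m ≤ σ t x)
    (hy : ContDiffOn ℝ 2 (Function.uncurry y) (Icc 0 T ×ˢ closure Ω))
    (hdiv : ∀ t ∈ Ioo 0 T, ∀ x ∈ Ω, planeDiv (y t) x = 0)
    -- an extension of the velocity to the plane, and its flow
    (Y : ℝ → Plane → Plane)
    (hY : ContDiffOn ℝ 2 (Function.uncurry Y) (Icc 0 T ×ˢ (univ : Set Plane)))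
    (hYy : ∀ t ∈ Icc 0 T, ∀ x ∈ closure Ω, Y t x = y t x)
    (X : ℝ → ℝ → Plane → Plane) (hX : IsFlow T Y X)
    -- every particle of the closure of `Ω` leaves it before time `T`
    (hout : closure Ω = outgoingSet Ω T X)
    -- the uncontrolled part of the boundary
    (Γ₀ : Set Plane) (hΓ₀ : ∃ U : Set Plane, IsOpen U ∧ Γ₀ = U ∩ frontier Ω)
    (hΓ₀fin : Finite (ConnectedComponents Γ₀))
    (hΓ₀out : ∃ γ : ℝ, 0 < γ ∧ ∀ t ∈ Icc 0 T, ∀ x ∈ closure Γ₀, ∀ ν, IsOuterNormal Ω x ν →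
      γ ≤ inner ℝ (y t x) ν) :
    ∃ 𝒪 : Set Plane, IsExtendedDomain Ω Γ₀ 𝒪 ∧ (𝒪 \ closure Ω).Nonempty ∧
      ∀ ω ω' : Set Plane, IsDomainSet ω → IsDomainSet ω' → ω ⊆ 𝒪 \ closure Ω →
        CompactlyIncluded ω' ω →
        ∃ ψ : ℝ → Plane → ℝ, IsTransportedWeight T Ω 𝒪 ω' y ψ := by
  obtain ⟨ρ, hρ⟩ := hΩ.exists_globalDefiningFunction
  have hconn : IsConnected Ω := hΩ.isDomain.2
  have hout' : ∀ t ∈ Icc 0 T, ∀ x ∈ closure Γ₀, x ∈ frontier Ω → 0 < fderiv ℝ ρ x (Y t x) := by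
    obtain ⟨γ, hγ, h⟩ := hΓ₀out
    intro t ht x hx hxf
    refine hρ.fderiv_pos_of_outerNormal (natCast_le_smooth 1) hxf hγ fun ν hν => ?_
    rw [hYy t ht x (frontier_subset_closure hxf)]
    exact h t ht x hx ν hν
  have hΓ₀f : Γ₀ ⊆ frontier Ω := by
    obtain ⟨U, -, rfl⟩ := hΓ₀
    exact inter_subset_right
  have hCf : closure Γ₀ ⊆ frontier Ω := closure_minimal hΓ₀f isClosed_frontier
  -- The only use of the assumption that all particles leave: it provides room to enlarge the
  -- domain.
  obtain ⟨w, hw, hwC⟩ : ∃ w ∈ frontier Ω, w ∉ closure Γ₀ := by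
    by_contra! hcon
    exact hρ.not_forall_outgoing (by simp) hconn.nonempty hT hY hX hout fun t ht x hx =>
      hout' t ht x (hcon x hx) hx
  obtain ⟨O, r, hr, hΩO, hOconn, hObdd, hOC, hOne⟩ :=
    hρ.exists_enlargement hconn hΩ.isBounded isClosed_closure hCf hw hwC
  refine ⟨O, ⟨⟨⟨hr.isOpen, hOconn⟩, hObdd, fun x hx => ⟨r, hr.isDefiningFunctionAt
    (by norm_num) hx⟩⟩, hΩO, fun x hx => ⟨?_, hΓ₀f hx⟩⟩, hOne, fun ω ω' _ hω' hωO hcomp => ?_⟩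
  · exact (hOC.symm.subset (subset_closure hx)).1
  obtain ⟨Yt, hYt, hYteq⟩ := exists_contDiff_two_extension_Icc hT hY
  obtain ⟨K, -, hω'K, hKω⟩ := hcomp
  obtain ⟨b, hb⟩ := hω'.2.nonempty
  -- The field will be stopped on a closed ball inside `ω'`; critical points confined to its
  -- interior are in particular in `ω'`.
  obtain ⟨ε, hε, hball⟩ := Metric.nhds_basis_closedBall.mem_iff.1 (hω'.1.mem_nhds hb)
  have hballO : Metric.closedBall b ε ⊆ O \ closure Ω := fun x hx => hωO (hKω (hω'K (hball hx)))
  have hdisj : Disjoint (Metric.closedBall b ε) (closure Ω ∪ frontier O) := by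
    rw [disjoint_left]
    rintro x hx (h | h)
    · exact (hballO hx).2 h
    · exact hr.isOpen.inter_frontier_eq.le ⟨(hballO hx).1, h⟩
  obtain ⟨V, hV, hVs, hVY, hVB, δ, hδ, hVout⟩ := exists_outward_field hT hr hObdd hΩO hYt
    (fun t ht x hx => by
      have hxC : x ∈ closure Γ₀ := hOC.subset hx
      -- Outwardness is known relative to Ω; since Ω ⊆ O, it passes to `O` at common boundary
      -- points, through the inward direction `-Y t x`.
      have h := hρ.fderiv_neg_of_subset hr (by simp) (by norm_num) hΩO (hCf hxC) hx.1
        (v := -Y t x) (by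
          rw [map_neg]
          exact neg_neg_of_pos (hout' t ht x hxC (hCf hxC)))
      rw [map_neg] at h
      rw [hYteq (t, x) ht]
      exact neg_neg_iff_pos.1 h)
    Metric.isClosed_closedBall hdisj
  obtain ⟨ψ, hψ⟩ := exists_isTransportedWeight (y := y) (B := Metric.ball b ε) hT hδ hr hOconn
    hObdd hΩO hV hVs
    (fun t ht x hx => by
      rw [hVY t ht x hx, hYteq (t, x) ht, ← hYy t ht x (subset_closure hx)]
      rfl)
    hVout Metric.isOpen_ball ⟨b, Metric.mem_ball_self hε⟩
    (fun x hx => (hballO (Metric.ball_subset_closedBall hx)).1)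
    (fun t x hx => hVB t x (Metric.ball_subset_closedBall hx))
  refine ⟨ψ, { hψ with noncritical := ?_ }⟩
  obtain ⟨α, hα, h⟩ := hψ.noncritical
  exact ⟨α, hα, fun t ht x hx => h t ht x
    ⟨hx.1, fun hxB => hx.2 (hball (Metric.ball_subset_closedBall hxB))⟩⟩
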